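/- Let $d\ge 1$, $\Omega=(0,1)^d$, $s>0$, $0<p,\tau\le\infty$ and $1\le q\le\infty$ satisfy $s>d/p$ and the primary-case condition $q<p+2sp/d$ (for $p=\infty$ this condition is regarded as satisfied for every $q$, including $q=\infty$). With $r$ the smallest integer strictly larger than $s$, $\Delta_h^r f(x)=\sum_{k=0}^r(-1)^{r-k}\binom rk f(x+kh)$, $\Omega_{rh}=\{x\in\Omega:[x,x+rh]\subset\Omega\}$ and $\omega_r(f,t)_p=\sup_{|h|\le t}\|\Delta_h^rf\|_{L_p(\Omega_{rh})}$, put $$\|f\|_{B^s_\tau(L_p(\Omega))}=\|f\|_{L_p(\Omega)}+\Big[\int_0^1\big(t^{-s}\omega_r(f,t)_p\big)^\tau\frac{dt}{t}\Big]^{1/\tau}$$ (the integral expression is replaced by $\sup_{0<t\le1}t^{-s}\omega_r(f,t)_p$ if $\tau=\infty$), and let $K=U(B^s_\tau(L_p(\Omega)))$ be the set of all $f\in C(\overline\Omega)$ with $\|f\|_{B^s_\tau(L_p(\Omega))}\le1$. For $m\ge1$ and $\sigma\ge0$ define the minimax risk $$R_m(K;\sigma)_q=\inf_{A,\mathcal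 X}\ \sup_{f\in K}\ \mathbb E\,\|f-A(y)\|_{L_q(\Omega)},\qquad y_i=f(x_i)+\eta_i,\quad i=1,\dots,m,$$ where the infimum is over all sets $\mathcal X=\{x_1,\dots,x_m\}\subset\overline\Omega$ of $m$ distinct data sites and all mappings $A:\mathbb R^m\to L_q(\Omega)$, and $\eta_1,\dots,\eta_m$ are i.i.d. Gaussian with mean $0$ and variance $\sigma^2$ (with $\eta_i=0$ if $\sigma=0$); the expectation is the upper expectation if the error is not measurable as a function of the noise. Then there is a constant $C>0$, depending only on $s,p,q,\tau$ and $d$, such that for all $m\ge1$ and all $\sigma\ge0$ $$R_m(K;\sigma)_q\ \ge\ C\left(m^{-\frac sd+\left(\frac1p-\frac1q\right)_+}+\min\left\{1,\left[\frac{\sigma^2}{m}\right]^{\frac{s}{2s+d}}\right\}\right).$$ -/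

import Mathlib

open MeasureTheory ProbabilityTheory Set
open scoped ENNReal NNReal

noncomputable section

namespace OptimalRecovery

/-- The open unit cube `Ω = (0,1)^d` in Euclidean space. -/
def unitCube (d : ℕ) : Set (EuclideanSpace ℝ (Fin d)) :=
  {x | ∀ i, x i ∈ Ioo (0 : ℝ) 1}

/-- Lebesgue measure on the unit cube. -/
abbrev cubeMeasure (d : ℕ) : Measure (EuclideanSpace ℝ (Fin d)) :=
  volume.restrict (unitCube d)

/-- The `r`-th difference `(-1)^r ∑_{k=0}^r (-1)^k (r choose k) f(x + k h)` of step `h`. -/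
def difference {d : ℕ} (r : ℕ) (h : EuclideanSpace ℝ (Fin d))
    (f : EuclideanSpace ℝ (Fin d) → ℝ) (x : EuclideanSpace ℝ (Fin d)) : ℝ :=
  (-1) ^ r * ∑ k ∈ Finset.range (r + 1), (-1) ^ k * (r.choose k : ℝ) * f (x + (k : ℝ) • h)

/-- The set `Ω_h` of the points `x ∈ Ω` for which the segment `[x, x + h]` lies in `Ω`. -/
def shrunkCube {d : ℕ} (h : EuclideanSpace ℝ (Fin d)) : Set (EuclideanSpace ℝ (Fin d)) :=
  {x | x ∈ unitCube d ∧ segment ℝ x (x + h) ⊆ unitCube d}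

/-- The modulus of smoothness
`ω_r(f,t)_p = sup_{|h| ≤ t} ‖Δ_h^r f‖_{L_p(Ω_{rh})}`, with values in `[0, ∞]`. -/
def modulus {d : ℕ} (r : ℕ) (p : ℝ≥0∞) (f : EuclideanSpace ℝ (Fin d) → ℝ) (t : ℝ) : ℝ≥0∞ :=
  ⨆ (h : EuclideanSpace ℝ (Fin d)) (_ : ‖h‖ ≤ t),
    eLpNorm (difference r h f) p (volume.restrict (shrunkCube ((r : ℝ) • h)))

/-- The Besov (quasi-)semi-norm of `B^s_τ(L_p(Ω))`, with values in `[0, ∞]`: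
`(∫_0^1 (t^{-s} ω_r(f,t)_p)^τ dt/t)^{1/τ}`, and the supremum of `t^{-s} ω_r(f,t)_p` over
`0 < t ≤ 1` if `τ = ∞`. Here `r = ⌊s⌋ + 1` is the smallest integer larger than `s`. -/
def besovSeminorm {d : ℕ} (s : ℝ) (p τ : ℝ≥0∞) (f : EuclideanSpace ℝ (Fin d) → ℝ) : ℝ≥0∞ :=
  if τ = ∞ then
    ⨆ (t : ℝ) (_ : t ∈ Ioc (0 : ℝ) 1),
      ENNReal.ofReal (t ^ (-s)) * modulus (⌊s⌋₊ + 1) p f t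
  else
    (∫⁻ t in Ioc (0 : ℝ) 1,
      (ENNReal.ofReal (t ^ (-s)) * modulus (⌊s⌋₊ + 1) p f t) ^ τ.toReal
        * ENNReal.ofReal t⁻¹) ^ (τ.toReal)⁻¹

/-- The Besov (quasi-)norm of `B^s_τ(L_p(Ω))`, with values in `[0, ∞]`. -/
def besovNorm {d : ℕ} (s : ℝ) (p τ : ℝ≥0∞) (f : EuclideanSpace ℝ (Fin d) → ℝ) : ℝ≥0∞ :=
  eLpNorm f p (cubeMeasure d) + besovSeminorm s p τ f

/-- The unit ball `U(B^s_τ(L_p(Ω)))` as a class of functions that are continuous on the closed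
cube (in the range `s > d/p` every element of the Besov space has exactly one such
representative, and point values on the closed cube are those of this representative).
The values of `f` outside the closed cube play no role. -/
def besovBall (d : ℕ) (s : ℝ) (p τ : ℝ≥0∞) : Set (EuclideanSpace ℝ (Fin d) → ℝ) :=
  {f | ContinuousOn f (closure (unitCube d)) ∧ besovNorm s p τ f ≤ 1}

/-- The upper integral of a `[0, ∞]`-valued function: the infimum of the integrals of its
measurable majorants. It is the usual integral as soon as the function is measurable, see
`upperIntegral_eq_lintegral`, and it makes sense for every function. -/
def upperIntegral {α : Type*} [MeasurableSpace α] (μ : Measure α) (g : α → ℝ≥0∞) : ℝ≥0∞ :=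
  ⨅ (φ : α → ℝ≥0∞) (_ : Measurable φ) (_ : g ≤ᵐ[μ] φ), ∫⁻ a, φ a ∂μ

theorem upperIntegral_eq_lintegral {α : Type*} [MeasurableSpace α] (μ : Measure α)
    (g : α → ℝ≥0∞) (hg : AEMeasurable g μ) : upperIntegral μ g = ∫⁻ a, g a ∂μ := by
  apply le_antisymm
  · refine (iInf_le_of_le (hg.mk g) (iInf_le_of_le hg.measurable_mk
      (iInf_le_of_le hg.ae_eq_mk.le ?_)))
    exact (lintegral_congr_ae hg.ae_eq_mk.symm).le
  · exact le_iInf fun φ => le_iInf fun _ => le_iInf fun h => lintegral_mono_ae h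

/-- The law of the noise vector `(η_1, …, η_m)`: i.i.d. Gaussian entries with mean `0` and
variance `σ²` (the point mass at `0` if `σ = 0`). -/
def noiseLaw (m : ℕ) (σ : ℝ≥0) : Measure (Fin m → ℝ) :=
  Measure.pi fun _ => gaussianReal 0 (σ ^ 2)

/-- The worst case risk `E_A(K; σ, 𝒳)_q = sup_{f ∈ K} 𝔼 ‖f - A(y)‖_{L_q(Ω)}` of an algorithm
`A : ℝ^m → L_q(Ω)` with data sites `x_1, …, x_m` and observations `y_i = f(x_i) + η_i`. -/
def algorithmRisk {d m : ℕ} (K : Set (EuclideanSpace ℝ (Fin d) → ℝ)) (σ : ℝ≥0) (q : ℝ≥0∞)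
    (x : Fin m → EuclideanSpace ℝ (Fin d)) (A : (Fin m → ℝ) → Lp ℝ q (cubeMeasure d)) : ℝ≥0∞ :=
  ⨆ f ∈ K, upperIntegral (noiseLaw m σ) fun η =>
    eLpNorm (fun z => f z - A (fun i => f (x i) + η i) z) q (cubeMeasure d)

/-- The minimax risk `R_m(K; σ)_q`: the infimum of the worst case risk over all sets of `m`
(distinct) data sites in the closed cube and all mappings `A : ℝ^m → L_q(Ω)`. -/
def minimaxRisk {d : ℕ} (K : Set (EuclideanSpace ℝ (Fin d) → ℝ)) (m : ℕ) (σ : ℝ≥0)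
    (q : ℝ≥0∞) : ℝ≥0∞ :=
  ⨅ (x : Fin m → EuclideanSpace ℝ (Fin d)) (_ : Function.Injective x)
    (_ : ∀ i, x i ∈ closure (unitCube d))
    (A : (Fin m → ℝ) → Lp ℝ q (cubeMeasure d)), algorithmRisk K σ q x A

end OptimalRecovery

end

namespace OptimalRecovery

/-! Both terms come from one family: sums of smooth bumps of amplitude `a`, with coefficients of
modulus at most one, on a set `S` of cells of the grid of mesh `1/M`. With `ρ = |S| / M^d`, such a
sum lies in the Besov ball as soon as `a ≤ c M^(-s) ρ^(-1/p)` (`exists_bumpSum_mem_besovBall`).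

For the first term take `M^d` comparable to `m` and at least `2m`, so that half of the cells contain
no site. A bump sum `f` on empty cells and its negative produce the same data at every noise level,
so the risk is at least `‖f‖_q`, of order `M^(-s) ρ^(1/q - 1/p)` (`eLpNorm_le_algorithmRisk`). Using
all empty cells is the right choice if `q ≤ p`, and a single one if `p ≤ q`.

For the second term put independent signs on all cells, with `a = c M^(-s)`. Flipping one sign
changes the data only at the sites of that cell. On average over the cells the squared change is at
most of order `a^2 m / M^d`, hence at most of order `σ^2` once `M^(2s+d) ≥ m / σ^2`. Most signs are
then undetectable, and Assouad's lemma (`assouad_bound`) gives an `L_1` error of order `a`, which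
bounds the `L_q` error from below because the cube has volume one. The least such `M ≥ 1` gives the
rate, truncated at a constant. -/

/-! ### Gaussian noise: joint density, symmetry and overlap of shifts -/

theorem lintegral_fin_prod_eq_prod {n : ℕ} (μ : Fin n → Measure ℝ) [∀ i, SigmaFinite (μ i)]
    (f : Fin n → ℝ → ℝ≥0∞) (hf : ∀ i, Measurable (f i)) :
    ∫⁻ x, ∏ i, f i (x i) ∂Measure.pi μ = ∏ i, ∫⁻ t, f i t ∂μ i := by
  induction n with
  | zero => simp [lintegral_unique]
  | succ n ih =>
    have e := (measurePreserving_piFinSuccAbove μ 0).symm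
    rw [← e.lintegral_comp_emb (MeasurableEquiv.measurableEmbedding _)]
    simp only [MeasurableEquiv.piFinSuccAbove_symm_apply, Fin.prod_univ_succ, Fin.insertNthEquiv,
      Equiv.coe_fn_mk, Fin.insertNth_zero', Fin.cons_zero, Fin.cons_succ, Fin.zero_succAbove]
    rw [lintegral_prod_mul (f := f 0) (g := fun y : Fin n → ℝ => ∏ i, f i.succ (y i))
      (hf 0).aemeasurable
      (Finset.measurable_prod _ fun i _ => (hf i.succ).comp (measurable_pi_apply i)).aemeasurable]
    rw [ih (fun i => μ i.succ) (fun i => f i.succ) fun i => hf i.succ]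

theorem pi_withDensity_eq {n : ℕ} (g : ℝ → ℝ≥0∞) (hg : Measurable g)
    [SigmaFinite ((volume : Measure ℝ).withDensity g)] :
    Measure.pi (fun _ : Fin n => (volume : Measure ℝ).withDensity g)
      = (volume : Measure (Fin n → ℝ)).withDensity fun y => ∏ i, g (y i) := by
  refine Measure.pi_eq fun s hs => ?_
  rw [withDensity_apply _ (MeasurableSet.univ_pi hs), volume_pi, Measure.restrict_pi_pi,
    lintegral_fin_prod_eq_prod _ (fun _ => g) fun _ => hg]
  exact Finset.prod_congr rfl fun i _ => (withDensity_apply _ (hs i)).symm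

/-- The joint density of `m` independent centred Gaussian variables of variance `v`. -/
noncomputable def noiseDensity (m : ℕ) (v : ℝ≥0) (y : Fin m → ℝ) : ℝ≥0∞ :=
  ∏ i, gaussianPDF 0 v (y i)

theorem measurable_noiseDensity (m : ℕ) (v : ℝ≥0) : Measurable (noiseDensity m v) :=
  Finset.measurable_prod _ fun i _ => (measurable_gaussianPDF 0 v).comp (measurable_pi_apply i)

instance (m : ℕ) (σ : ℝ≥0) : IsProbabilityMeasure (noiseLaw m σ) := by
  unfold noiseLaw; infer_instance

theorem noiseLaw_eq_withDensity (m : ℕ) {σ : ℝ≥0} (hσ : σ ≠ 0) :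
    noiseLaw m σ = volume.withDensity (noiseDensity m (σ ^ 2)) := by
  have h : gaussianReal 0 (σ ^ 2) = volume.withDensity (gaussianPDF 0 (σ ^ 2)) :=
    gaussianReal_of_var_ne_zero _ (pow_ne_zero 2 hσ)
  have : SigmaFinite ((volume : Measure ℝ).withDensity (gaussianPDF 0 (σ ^ 2))) := by
    rw [← h]; infer_instance
  unfold noiseLaw
  simp only [h]
  exact pi_withDensity_eq _ (measurable_gaussianPDF _ _)

theorem noiseLaw_map_neg (m : ℕ) (σ : ℝ≥0) : (noiseLaw m σ).map (fun η => -η) = noiseLaw m σ := by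
  have := Measure.pi_map_pi (μ := fun _ : Fin m => gaussianReal 0 (σ ^ 2))
    (f := fun _ t => -t) (fun _ => measurable_neg.aemeasurable)
  simp only [gaussianReal_map_neg, neg_zero] at this
  exact this

/-- The law is symmetric, and the half-space together with its reflection covers everything. -/
theorem half_le_noiseLaw_halfSpace (m : ℕ) (σ : ℝ≥0) (v : Fin m → ℝ) :
    2⁻¹ ≤ noiseLaw m σ {η | 0 ≤ ∑ j, v j * η j} := by
  set H : Set (Fin m → ℝ) := {η | 0 ≤ ∑ j, v j * η j}
  have hm : Measurable fun η : Fin m → ℝ => ∑ j, v j * η j := by fun_prop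
  have hH : MeasurableSet H := measurableSet_le measurable_const hm
  have hneg : noiseLaw m σ ((fun η => -η) ⁻¹' H) = noiseLaw m σ H := by
    rw [← Measure.map_apply measurable_neg hH, noiseLaw_map_neg]
  have hun : H ∪ (fun η => -η) ⁻¹' H = univ := by
    ext η
    simp only [H, mem_union, mem_ofPred_eq, mem_preimage, Pi.neg_apply, mul_neg,
      Finset.sum_neg_distrib, mem_univ, iff_true]
    rcases le_total 0 (∑ j, v j * η j) with h | h
    · exact Or.inl h
    · exact Or.inr (by linarith)
  have h1 : (1 : ℝ≥0∞) ≤ noiseLaw m σ H + noiseLaw m σ H := by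
    calc (1 : ℝ≥0∞) = noiseLaw m σ univ := measure_univ.symm
      _ ≤ noiseLaw m σ H + noiseLaw m σ ((fun η => -η) ⁻¹' H) := hun ▸ measure_union_le _ _
      _ = _ := by rw [hneg]
  rw [← two_mul] at h1
  rw [ENNReal.inv_le_iff_le_mul (by simp) (by simp)]
  exact h1

theorem gaussianPDFReal_mul_exp_le {v : ℝ≥0} (hv : v ≠ 0) (t u : ℝ) :
    gaussianPDFReal 0 v t * Real.exp (-(u ^ 2 / (2 * v))) * Real.exp (u * t / v)
      = gaussianPDFReal 0 v (t - u) := by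
  have : (v : ℝ) ≠ 0 := by exact_mod_cast hv
  simp only [gaussianPDFReal, mul_assoc, ← Real.exp_add]
  congr 3
  field_simp
  ring

/-- Shifting a Gaussian density by `u` multiplies it by `exp(-|u|²/2v) exp(⟨u, η⟩/v)`; on the
half-space the second factor is at least one. -/
theorem noiseDensity_sub_ge {m : ℕ} {v : ℝ≥0} (hv : v ≠ 0) (η u : Fin m → ℝ)
    (h : 0 ≤ ∑ j, u j * η j) :
    noiseDensity m v η * ENNReal.ofReal (Real.exp (-((∑ j, u j ^ 2) / (2 * v))))
      ≤ noiseDensity m v (η - u) := by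
  have hnn : ∀ t, 0 ≤ gaussianPDFReal 0 v t := gaussianPDFReal_nonneg 0 v
  simp only [noiseDensity, gaussianPDF]
  rw [← ENNReal.ofReal_prod_of_nonneg fun i _ => hnn _,
    ← ENNReal.ofReal_prod_of_nonneg fun i _ => hnn _,
    ← ENNReal.ofReal_mul (Finset.prod_nonneg fun i _ => hnn _)]
  refine ENNReal.ofReal_le_ofReal ?_
  simp only [Pi.sub_apply, ← gaussianPDFReal_mul_exp_le hv, Finset.prod_mul_distrib,
    ← Real.exp_sum]
  rw [Finset.sum_neg_distrib, ← Finset.sum_div, ← Finset.sum_div]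
  refine le_mul_of_one_le_right ?_ (Real.one_le_exp (by positivity))
  exact mul_nonneg (Finset.prod_nonneg fun i _ => hnn _) (Real.exp_nonneg _)

/-- Two Gaussian shift experiments at distance of the order of the noise level overlap. -/
theorem lintegral_min_noiseDensity_ge {m : ℕ} {σ : ℝ≥0} (hσ : σ ≠ 0) (a b : Fin m → ℝ) :
    2⁻¹ * ENNReal.ofReal (Real.exp (-((∑ j, (b j - a j) ^ 2) / (2 * σ ^ 2))))
      ≤ ∫⁻ y, min (noiseDensity m (σ ^ 2) (y - a)) (noiseDensity m (σ ^ 2) (y - b)) := by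
  set u : Fin m → ℝ := b - a
  set H : Set (Fin m → ℝ) := {η | 0 ≤ ∑ j, u j * η j}
  set ρ := noiseDensity m (σ ^ 2)
  set c := ENNReal.ofReal (Real.exp (-((∑ j, u j ^ 2) / (2 * ((σ ^ 2 : ℝ≥0) : ℝ)))))
  have hc : c ≤ 1 := by
    refine ENNReal.ofReal_le_one.2 (Real.exp_le_one_iff.2 ?_)
    exact neg_nonpos.2 (by positivity)
  have hm : Measurable fun η : Fin m → ℝ => ∑ j, u j * η j := by fun_prop
  have hH : MeasurableSet H := measurableSet_le measurable_const hm
  -- Translation invariance reduces the pair of shifts `a`, `b` to the pair `0`, `u = b - a`.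
  have hsub : ∫⁻ y, min (ρ (y - a)) (ρ (y - b)) = ∫⁻ η, min (ρ η) (ρ (η - u)) := by
    rw [← lintegral_sub_right_eq_self (fun η => min (ρ η) (ρ (η - u))) a]
    simp only [u, sub_sub, add_sub_cancel]
  rw [hsub]
  calc 2⁻¹ * ENNReal.ofReal (Real.exp (-((∑ j, (b j - a j) ^ 2) / (2 * σ ^ 2))))
      = 2⁻¹ * c := by simp [c, u]
    _ ≤ noiseLaw m σ H * c := by gcongr; exact half_le_noiseLaw_halfSpace m σ u
    _ = ∫⁻ η in H, ρ η * c := by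
      rw [lintegral_mul_const _ (measurable_noiseDensity _ _), noiseLaw_eq_withDensity m hσ,
        withDensity_apply _ hH]
    _ ≤ ∫⁻ η in H, min (ρ η) (ρ (η - u)) := by
      refine setLIntegral_mono' hH fun η hη => le_min (mul_le_of_le_one_right' hc) ?_
      exact noiseDensity_sub_ge (pow_ne_zero 2 hσ) η u hη
    _ ≤ _ := setLIntegral_le_lintegral _ _

/-- Passing from the noise to the observation as variable puts all hypotheses over the same Lebesgue
measure, where their densities can be compared pointwise. -/
theorem lintegral_noiseLaw_shift {m : ℕ} {σ : ℝ≥0} (hσ : σ ≠ 0) {φ : (Fin m → ℝ) → ℝ≥0∞}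
    (hφ : Measurable φ) (a : Fin m → ℝ) :
    ∫⁻ η, φ η ∂noiseLaw m σ = ∫⁻ y, noiseDensity m (σ ^ 2) (y - a) * φ (y - a) := by
  rw [noiseLaw_eq_withDensity m hσ,
    lintegral_withDensity_eq_lintegral_mul _ (measurable_noiseDensity _ _) hφ,
    ← lintegral_sub_right_eq_self _ a]
  rfl

/-! ### Upper expectations and testing lower bounds -/

/-- Adding `∞` on a measurable null set containing the exceptional points turns an almost everywhere
majorant into an everywhere one at no cost. Pointwise inequalities between losses can then be
integrated without measurability of the algorithm. -/
theorem exists_measurable_ge_of_upperIntegral_lt {α : Type*} [MeasurableSpace α] {μ : Measure α}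
    {g : α → ℝ≥0∞} {B : ℝ≥0∞} (h : upperIntegral μ g < B) :
    ∃ φ : α → ℝ≥0∞, Measurable φ ∧ (∀ x, g x ≤ φ x) ∧ ∫⁻ x, φ x ∂μ < B := by
  simp only [upperIntegral, iInf_lt_iff] at h
  obtain ⟨φ, hφ, hle, hlt⟩ := h
  set T := toMeasurable μ {x | ¬ g x ≤ φ x}
  have hT0 : μ T = 0 := by rw [measure_toMeasurable]; exact hle
  have hT : MeasurableSet T := measurableSet_toMeasurable _ _
  refine ⟨fun x => φ x + T.indicator (fun _ => ∞) x, hφ.add (measurable_const.indicator hT),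
    fun x => ?_, ?_⟩
  · by_cases hx : g x ≤ φ x
    · exact hx.trans le_self_add
    · have : x ∈ T := subset_toMeasurable _ _ hx
      simp [this]
  · rw [lintegral_add_left hφ, lintegral_indicator hT]
    simpa [hT0] using hlt

/-- A two-point lower bound for one pair of experiments with the same data. -/
theorem two_point_bound {α : Type*} [MeasurableSpace α] {μ : Measure α} [IsProbabilityMeasure μ]
    {g₁ g₂ : α → ℝ≥0∞} {b R : ℝ≥0∞} (hb : ∀ x, 2 * b ≤ g₁ x + g₂ x)
    (h₁ : upperIntegral μ g₁ ≤ R) (h₂ : upperIntegral μ g₂ ≤ R) : b ≤ R := by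
  by_contra! hlt
  obtain ⟨φ₁, hm₁, hφ₁, hl₁⟩ := exists_measurable_ge_of_upperIntegral_lt (h₁.trans_lt hlt)
  obtain ⟨φ₂, hm₂, hφ₂, hl₂⟩ := exists_measurable_ge_of_upperIntegral_lt (h₂.trans_lt hlt)
  refine (ENNReal.add_lt_add hl₁ hl₂).not_ge ?_
  rw [← lintegral_add_left hm₁, ← two_mul]
  calc 2 * b = ∫⁻ _, 2 * b ∂μ := by simp
    _ ≤ _ := lintegral_mono fun x => (hb x).trans (add_le_add (hφ₁ x) (hφ₂ x))

/-- **Assouad's lemma** for Gaussian shift experiments and upper expectations: `2^N` hypotheses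
`ω` with data means `a ω` and losses `G ω` that split over the coordinates of `ω`. -/
theorem assouad_bound {ι : Type*} [Fintype ι] [DecidableEq ι] {m : ℕ} {σ : ℝ≥0} (hσ : σ ≠ 0)
    (a : (ι → Bool) → Fin m → ℝ) (G : (ι → Bool) → (Fin m → ℝ) → ℝ≥0∞)
    (l : ι → Bool → (Fin m → ℝ) → ℝ≥0∞) {b R : ℝ≥0∞} (β : ι → ℝ)
    (hG : ∀ ω y, ∑ i, l i (ω i) y ≤ G ω y)
    (hl : ∀ i y, 2 * b ≤ l i true y + l i false y)
    (hβ : ∀ ω i, (∑ j, (a (Function.update ω i (!ω i)) j - a ω j) ^ 2) / (2 * σ ^ 2) ≤ β i)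
    (hR : ∀ ω, upperIntegral (noiseLaw m σ) (fun η => G ω (a ω + η)) ≤ R) :
    b * ∑ i, 2⁻¹ * ENNReal.ofReal (Real.exp (-β i)) ≤ R := by
  set B := b * ∑ i, 2⁻¹ * ENNReal.ofReal (Real.exp (-β i)) with hB
  by_contra! hlt
  choose φ hφm hφ hφl using fun ω => exists_measurable_ge_of_upperIntegral_lt
    ((hR ω).trans_lt hlt)
  set ρ := noiseDensity m (σ ^ 2)
  have hρ : Measurable ρ := measurable_noiseDensity _ _
  have hmeas : ∀ ω, Measurable fun y => ρ (y - a ω) := fun ω => hρ.comp (measurable_sub_const _)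
  set flip : ι → (ι → Bool) → (ι → Bool) := fun i ω => Function.update ω i (!ω i)
  have hflip : ∀ i, Function.Involutive (flip i) := fun i ω => by simp [flip]
  have hpt : ∀ y, ∑ ω, ∑ i, b * min (ρ (y - a ω)) (ρ (y - a (flip i ω)))
      ≤ ∑ ω, ρ (y - a ω) * φ ω (y - a ω) := by
    intro y
    -- For fixed `i` each hypothesis is paired with its flip at `i`. Reindexing by this involution
    -- writes twice the sum as a sum over pairs; in each pair the two losses add up to at least `2 *
    -- b`, and both densities dominate their minimum.
    have key : ∀ i, ∑ ω, b * min (ρ (y - a ω)) (ρ (y - a (flip i ω)))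
        ≤ ∑ ω, ρ (y - a ω) * l i (ω i) y := by
      intro i
      have hre : ∑ ω, ρ (y - a (flip i ω)) * l i (!ω i) y = ∑ ω, ρ (y - a ω) * l i (ω i) y := by
        rw [← Equiv.sum_comp (hflip i).toPerm fun ω => ρ (y - a ω) * l i (ω i) y]
        simp [flip]
      have h2 : 2 * ∑ ω, b * min (ρ (y - a ω)) (ρ (y - a (flip i ω)))
          ≤ 2 * ∑ ω, ρ (y - a ω) * l i (ω i) y := by
        rw [two_mul (∑ ω, ρ (y - a ω) * l i (ω i) y)]
        nth_rewrite 2 [← hre]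
        rw [← Finset.sum_add_distrib, Finset.mul_sum]
        refine Finset.sum_le_sum fun ω _ => ?_
        have hlω : 2 * b ≤ l i (ω i) y + l i (!ω i) y := by
          cases ω i
          · simpa [add_comm] using hl i y
          · simpa using hl i y
        set M := min (ρ (y - a ω)) (ρ (y - a (flip i ω)))
        calc 2 * (b * M) = M * (2 * b) := by ring
          _ ≤ M * (l i (ω i) y + l i (!ω i) y) := by gcongr
          _ = M * l i (ω i) y + M * l i (!ω i) y := mul_add _ _ _
          _ ≤ _ := by
            gcongr
            · exact min_le_left _ _
            · exact min_le_right _ _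
      exact (ENNReal.mul_le_mul_iff_right (by simp) (by simp)).1 h2
    calc _ = ∑ i, ∑ ω, b * min (ρ (y - a ω)) (ρ (y - a (flip i ω))) := Finset.sum_comm
      _ ≤ ∑ i, ∑ ω, ρ (y - a ω) * l i (ω i) y := Finset.sum_le_sum fun i _ => key i
      _ = ∑ ω, ρ (y - a ω) * ∑ i, l i (ω i) y := by
        rw [Finset.sum_comm]; simp only [Finset.mul_sum]
      _ ≤ _ := by
        refine Finset.sum_le_sum fun ω _ => ?_
        gcongr
        refine (hG ω y).trans ?_
        simpa using hφ ω (y - a ω)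
  have hmeasφ : ∀ ω, Measurable fun y => ρ (y - a ω) * φ ω (y - a ω) := fun ω =>
    (hmeas ω).mul ((hφm ω).comp (measurable_sub_const _))
  have hint := lintegral_mono (μ := volume) hpt
  rw [lintegral_finsetSum _ fun ω _ =>
      (Finset.measurable_sum _ fun i _ => ((hmeas ω).min (hmeas _)).const_mul b),
    lintegral_finsetSum _ fun ω _ => hmeasφ ω] at hint
  -- Each of the finitely many hypotheses has expected loss strictly below `B`, whereas the overlap
  -- integrals contribute at least `B` for every `ω`.
  refine absurd hint (not_le.2 (ENNReal.sum_lt_sum_of_nonempty Finset.univ_nonempty fun ω _ => ?_))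
  rw [← lintegral_noiseLaw_shift hσ (hφm ω) (a ω)]
  refine (hφl ω).trans_le ?_
  rw [lintegral_finsetSum _ fun i _ => ((hmeas ω).min (hmeas _)).const_mul b, hB, Finset.mul_sum]
  refine Finset.sum_le_sum fun i _ => ?_
  rw [lintegral_const_mul _ ((hmeas ω).min (hmeas _))]
  gcongr
  refine le_trans ?_ (lintegral_min_noiseDensity_ge hσ (a ω) (a (flip i ω)))
  gcongr
  exact hβ ω i

/-! ### Finite differences -/

section Difference

variable {d : ℕ}

theorem difference_eq_fwdDiff_iter (r : ℕ) (h : EuclideanSpace ℝ (Fin d))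
    (f : EuclideanSpace ℝ (Fin d) → ℝ) (x : EuclideanSpace ℝ (Fin d)) :
    difference r h f x = (fwdDiff h)^[r] f x := by
  rw [fwdDiff_iter_eq_sum_shift, difference, Finset.mul_sum]
  refine Finset.sum_congr rfl fun k hk => ?_
  have hk : k ≤ r := Nat.lt_succ_iff.1 (Finset.mem_range.1 hk)
  rw [zsmul_eq_mul, ← Nat.cast_smul_eq_nsmul ℝ k h]
  have : ((-1 : ℝ)) ^ r * (-1) ^ k = (-1) ^ (r - k) := by
    obtain ⟨n, rfl⟩ := Nat.exists_eq_add_of_le hk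
    rw [Nat.add_sub_cancel_left, pow_add, mul_right_comm, ← pow_add, ← two_mul, pow_mul]
    simp
  push_cast
  rw [← this]
  ring

/-- Iterated differences of order `r` of a smooth compactly supported function are
`O(‖h‖ ^ r)`, uniformly. -/
theorem exists_norm_fwdDiff_iter_le {E : Type} [NormedAddCommGroup E] [NormedSpace ℝ E] (r : ℕ) :
    -- The target space varies because the induction passes from `f` to its derivative, which takes
    -- values in a space of linear maps.
    ∀ {F : Type} [NormedAddCommGroup F] [NormedSpace ℝ F] (f : E → F),
      ContDiff ℝ r f → HasCompactSupport f →
      ∃ C : ℝ, 0 ≤ C ∧ ∀ h x, ‖(fwdDiff h)^[r] f x‖ ≤ C * ‖h‖ ^ r := by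
  induction r with
  | zero =>
    intro F _ _ f hf hc
    obtain ⟨C, hC⟩ := hf.continuous.bounded_above_of_compact_support hc
    exact ⟨C, (norm_nonneg _).trans (hC 0), fun h x => by simpa using hC x⟩
  | succ r ih =>
    intro F _ _ f hf hc
    have hf1 : ContDiff ℝ r (fderiv ℝ f) := hf.fderiv_right (by norm_cast)
    obtain ⟨C, hC0, hC⟩ := ih (fderiv ℝ f) hf1 (hc.fderiv ℝ)
    refine ⟨C, hC0, fun h x => ?_⟩
    have hdiff : Differentiable ℝ f := hf.differentiable (by simp)
    -- Differences commute with differentiation, so the induction hypothesis bounds the derivative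
    -- of the `r`-th difference; the mean value inequality then supplies one more factor `‖h‖`.
    have hder : ∀ y, HasFDerivAt ((fwdDiff h)^[r] f) ((fwdDiff h)^[r] (fderiv ℝ f) y) y := by
      intro y
      have h1 : (fwdDiff h)^[r] f = fun z => ∑ k ∈ Finset.range (r + 1),
          ((-1 : ℤ) ^ (r - k) * r.choose k) • f (z + k • h) :=
        funext fun z => fwdDiff_iter_eq_sum_shift h f r z
      rw [h1, fwdDiff_iter_eq_sum_shift]
      refine HasFDerivAt.fun_sum fun k _ => ?_
      have h2 : HasFDerivAt (fun z => f (z + k • h)) (fderiv ℝ f (y + k • h)) y :=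
        (hasFDerivAt_comp_add_right (k • h)).2 (hdiff (y + k • h)).hasFDerivAt
      simp only [← Int.cast_smul_eq_zsmul ℝ]
      exact h2.const_smul _
    rw [Function.iterate_succ_apply']
    have := Convex.norm_image_sub_le_of_norm_hasFDerivWithin_le (s := univ) (x := x) (y := x + h)
      (fun y _ => (hder y).hasFDerivWithinAt) (fun y _ => hC h y) convex_univ (mem_univ _)
      (mem_univ _)
    rw [add_sub_cancel_left] at this
    calc _ ≤ C * ‖h‖ ^ r * ‖h‖ := this
      _ = _ := by ring

theorem difference_comp_smul (r : ℕ) (h : EuclideanSpace ℝ (Fin d))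
    (g : EuclideanSpace ℝ (Fin d) → ℝ) (a c : ℝ) (x : EuclideanSpace ℝ (Fin d)) :
    difference r h (fun x => a * g (c • x)) x = a * difference r (c • h) g (c • x) := by
  simp only [difference, Finset.mul_sum, smul_add, smul_comm c]
  exact Finset.sum_congr rfl fun k _ => by ring

theorem difference_finset_sum {ι : Type*} (I : Finset ι) (w : ι → ℝ)
    (n : ι → EuclideanSpace ℝ (Fin d)) (g : EuclideanSpace ℝ (Fin d) → ℝ) (r : ℕ)
    (h x : EuclideanSpace ℝ (Fin d)) :
    difference r h (fun y => ∑ i ∈ I, w i * g (y - n i)) x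
      = ∑ i ∈ I, w i * difference r h g (x - n i) := by
  simp only [difference, Finset.mul_sum]
  rw [Finset.sum_comm]
  refine Finset.sum_congr rfl fun i _ => Finset.sum_congr rfl fun k _ => ?_
  rw [sub_add_eq_add_sub]
  ring

theorem abs_difference_le (r : ℕ) (h : EuclideanSpace ℝ (Fin d))
    {g : EuclideanSpace ℝ (Fin d) → ℝ} (hg : ∀ x, |g x| ≤ 1) (x : EuclideanSpace ℝ (Fin d)) :
    |difference r h g x| ≤ 2 ^ r := by
  rw [difference, abs_mul, abs_pow, abs_neg, abs_one, one_pow, one_mul]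
  calc _ ≤ ∑ k ∈ Finset.range (r + 1), |(-1) ^ k * (r.choose k : ℝ) * g (x + (k : ℝ) • h)| :=
        Finset.abs_sum_le_sum_abs _ _
    _ ≤ ∑ k ∈ Finset.range (r + 1), (r.choose k : ℝ) := by
        refine Finset.sum_le_sum fun k _ => ?_
        rw [abs_mul, abs_mul, abs_pow, abs_neg, abs_one, one_pow, one_mul, Nat.abs_cast]
        exact mul_le_of_le_one_right (Nat.cast_nonneg _) (hg _)
    _ = 2 ^ r := by exact_mod_cast Nat.sum_range_choose r

theorem difference_eq_zero {r : ℕ} {h : EuclideanSpace ℝ (Fin d)}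
    {g : EuclideanSpace ℝ (Fin d) → ℝ} {x : EuclideanSpace ℝ (Fin d)}
    (hg : ∀ k ∈ Finset.range (r + 1), g (x + (k : ℝ) • h) = 0) : difference r h g x = 0 := by
  rw [difference, Finset.sum_eq_zero, mul_zero]
  intro k hk
  rw [hg k hk, mul_zero]

end Difference

/-! ### Bumps on lattice cells -/

section Bump

variable (d : ℕ)

theorem isOpen_unitCube : IsOpen (unitCube d) := by
  have : unitCube d = ⋂ i, (fun x : EuclideanSpace ℝ (Fin d) => x i) ⁻¹' Ioo 0 1 := by
    ext x; simp [unitCube]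
  rw [this]
  exact isOpen_iInter_of_finite fun i => isOpen_Ioo.preimage (by fun_prop)

theorem volume_unitCube : volume (unitCube d) = 1 := by
  have : unitCube d = (WithLp.ofLp : EuclideanSpace ℝ (Fin d) → Fin d → ℝ) ⁻¹'
      univ.pi fun _ => Ioo (0 : ℝ) 1 := by
    ext x; simp [unitCube]
  rw [this, (PiLp.volume_preserving_ofLp (Fin d)).measure_preimage
    (MeasurableSet.univ_pi fun _ => measurableSet_Ioo).nullMeasurableSet, volume_pi_pi]
  simp

instance : IsProbabilityMeasure (cubeMeasure d) :=
  ⟨by rw [Measure.restrict_apply_univ, volume_unitCube]⟩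

/-- The centre of the unit cube. -/
noncomputable def cubeCenter : EuclideanSpace ℝ (Fin d) := WithLp.toLp 2 fun _ => 1 / 2

/-- A smooth bump supported in the unit cube. -/
noncomputable def bump : ContDiffBump (cubeCenter d) := ⟨1 / 8, 1 / 4, by norm_num, by norm_num⟩

variable {d}

theorem mem_unitCube_of_bump_ne_zero {x : EuclideanSpace ℝ (Fin d)} (h : bump d x ≠ 0) :
    x ∈ unitCube d := by
  have hx : x ∈ Metric.ball (cubeCenter d) (1 / 4) := by
    have : x ∈ Function.support (bump d) := h
    rwa [ContDiffBump.support_eq] at this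
  intro i
  have h1 : |x i - 1 / 2| ≤ dist x (cubeCenter d) := by
    rw [dist_eq_norm]
    exact PiLp.norm_apply_le (x - cubeCenter d) i
  have h2 := abs_lt.1 (h1.trans_lt (Metric.mem_ball.1 hx))
  constructor <;> linarith [h2.1, h2.2]

theorem abs_bump_le_one (x : EuclideanSpace ℝ (Fin d)) : |bump d x| ≤ 1 :=
  abs_le.2 ⟨by linarith [(bump d).nonneg' x], (bump d).le_one⟩

/-- Smoothness governs small steps, the trivial bound `2 ^ r` large ones. -/
theorem exists_abs_difference_bump_le (d r : ℕ) :
    ∃ C : ℝ, 0 ≤ C ∧ ∀ h x, |difference r h (bump d) x| ≤ C * min 1 (‖h‖ ^ r) := by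
  obtain ⟨C, hC0, hC⟩ := exists_norm_fwdDiff_iter_le r (bump d) (bump d).contDiff
    (bump d).hasCompactSupport
  refine ⟨max C (2 ^ r), le_max_of_le_left hC0, fun h x => ?_⟩
  rcases le_total 1 (‖h‖ ^ r) with h1 | h1
  · rw [min_eq_left h1, mul_one]
    exact (abs_difference_le r h abs_bump_le_one x).trans (le_max_right _ _)
  · rw [min_eq_right h1, difference_eq_fwdDiff_iter]
    exact (hC h x).trans (by gcongr; exact le_max_left _ _)

/-- The corner of a lattice cube. -/
noncomputable def node {M : ℕ} (i : Fin d → Fin M) : EuclideanSpace ℝ (Fin d) :=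
  WithLp.toLp 2 fun k => (i k : ℝ)

theorem node_eq_of_mem {M : ℕ} {i j : Fin d → Fin M} {y : EuclideanSpace ℝ (Fin d)}
    (hi : y - node i ∈ unitCube d) (hj : y - node j ∈ unitCube d) : i = j := by
  funext k
  have h1 : y k - (i k : ℝ) ∈ Ioo (0 : ℝ) 1 := hi k
  have h2 : y k - (j k : ℝ) ∈ Ioo (0 : ℝ) 1 := hj k
  have h3 : ((i k : ℕ) : ℝ) < (j k : ℕ) + 1 := by linarith [h1.1, h2.2]
  have h4 : ((j k : ℕ) : ℝ) < (i k : ℕ) + 1 := by linarith [h2.1, h1.2]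
  norm_cast at h3 h4
  exact Fin.ext (by omega)

open scoped Classical in
theorem sum_indicator_unitCube_le_one {M : ℕ} (y : EuclideanSpace ℝ (Fin d)) :
    ∑ i : Fin d → Fin M, (if y - node i ∈ unitCube d then (1 : ℝ) else 0) ≤ 1 := by
  rw [Finset.sum_boole]
  have : (Finset.univ.filter fun i : Fin d → Fin M => y - node i ∈ unitCube d).card ≤ 1 :=
    Finset.card_le_one.2 fun i hi j hj =>
      node_eq_of_mem (Finset.mem_filter.1 hi).2 (Finset.mem_filter.1 hj).2
  exact_mod_cast this

/-- A linear combination of bumps at lattice cubes. -/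
noncomputable def bumpSum {M : ℕ} (w : (Fin d → Fin M) → ℝ) (y : EuclideanSpace ℝ (Fin d)) : ℝ :=
  ∑ i, w i * bump d (y - node i)

theorem continuous_bumpSum {M : ℕ} (w : (Fin d → Fin M) → ℝ) : Continuous (bumpSum w) := by
  unfold bumpSum
  refine continuous_finsetSum _ fun i _ => continuous_const.mul ?_
  exact (bump d).continuous.comp (continuous_id.sub continuous_const)

theorem bumpSum_eq_of_mem {M : ℕ} (w : (Fin d → Fin M) → ℝ) {i : Fin d → Fin M}
    {y : EuclideanSpace ℝ (Fin d)} (hy : y - node i ∈ unitCube d) :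
    bumpSum w y = w i * bump d (y - node i) := by
  refine Finset.sum_eq_single i (fun j _ hj => ?_) (by simp)
  by_contra h
  exact hj (node_eq_of_mem (mem_unitCube_of_bump_ne_zero (right_ne_zero_of_mul h)) hy)

theorem exists_of_bumpSum_ne_zero {M : ℕ} {w : (Fin d → Fin M) → ℝ}
    {y : EuclideanSpace ℝ (Fin d)} (h : bumpSum w y ≠ 0) :
    ∃ i, w i ≠ 0 ∧ y - node i ∈ unitCube d := by
  obtain ⟨i, _, hi⟩ := Finset.exists_ne_zero_of_sum_ne_zero h
  exact ⟨i, left_ne_zero_of_mul hi, mem_unitCube_of_bump_ne_zero (right_ne_zero_of_mul hi)⟩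

theorem abs_bumpSum_le_one {M : ℕ} {w : (Fin d → Fin M) → ℝ} (hw : ∀ i, |w i| ≤ 1)
    (y : EuclideanSpace ℝ (Fin d)) : |bumpSum w y| ≤ 1 := by
  by_cases h : bumpSum w y = 0
  · simp [h]
  · obtain ⟨i, -, hi⟩ := exists_of_bumpSum_ne_zero h
    rw [bumpSum_eq_of_mem w hi, abs_mul]
    exact mul_le_one₀ (hw i) (abs_nonneg _) (abs_bump_le_one _)

/-- Each of the `r + 1` points used by the difference lies in at most one cell, so at most `r + 1`
bumps contribute. Hence the constant does not depend on `M`. -/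
theorem abs_difference_bumpSum_le {M r : ℕ} {C : ℝ} (hC0 : 0 ≤ C)
    (hC : ∀ h x, |difference r h (bump d) x| ≤ C * min 1 (‖h‖ ^ r))
    {w : (Fin d → Fin M) → ℝ} (hw : ∀ i, |w i| ≤ 1) (h y : EuclideanSpace ℝ (Fin d)) :
    |difference r h (bumpSum w) y| ≤ (r + 1) * C * min 1 (‖h‖ ^ r) := by
  classical
  set B := C * min 1 (‖h‖ ^ r)
  have hB : 0 ≤ B := mul_nonneg hC0 (le_min zero_le_one (by positivity))
  have hterm : ∀ i, |w i * difference r h (bump d) (y - node i)| ≤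
      ∑ k ∈ Finset.range (r + 1),
        (if y + (k : ℝ) • h - node i ∈ unitCube d then (1 : ℝ) else 0) * B := by
    intro i
    have hnn : ∀ k ∈ Finset.range (r + 1),
        0 ≤ (if y + (k : ℝ) • h - node i ∈ unitCube d then (1 : ℝ) else 0) * B :=
      fun k _ => mul_nonneg (by split_ifs <;> norm_num) hB
    by_cases hex : ∃ k ∈ Finset.range (r + 1), y + (k : ℝ) • h - node i ∈ unitCube d
    · obtain ⟨k, hk, hmem⟩ := hex
      refine le_trans ?_ (Finset.single_le_sum hnn hk)
      rw [if_pos hmem, one_mul, abs_mul]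
      exact (mul_le_of_le_one_left (abs_nonneg _) (hw i)).trans (hC h _)
    · push Not at hex
      rw [difference_eq_zero, mul_zero, abs_zero]
      · exact Finset.sum_nonneg hnn
      · intro k hk
        by_contra hne
        apply hex k hk
        have := mem_unitCube_of_bump_ne_zero hne
        rwa [sub_add_eq_add_sub] at this
  unfold bumpSum
  rw [difference_finset_sum]
  calc _ ≤ ∑ i, |w i * difference r h (bump d) (y - node i)| := Finset.abs_sum_le_sum_abs _ _
    _ ≤ _ := Finset.sum_le_sum fun i _ => hterm i
    _ = ∑ k ∈ Finset.range (r + 1), (∑ i : Fin d → Fin M,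
          (if y + (k : ℝ) • h - node i ∈ unitCube d then (1 : ℝ) else 0)) * B := by
        rw [Finset.sum_comm]; simp only [Finset.sum_mul]
    _ ≤ ∑ k ∈ Finset.range (r + 1), 1 * B := by
        gcongr
        exact sum_indicator_unitCube_le_one _
    _ = _ := by
        rw [Finset.sum_const, Finset.card_range, nsmul_eq_mul]
        push_cast
        ring

theorem exists_of_difference_bumpSum_ne_zero {M r : ℕ} {w : (Fin d → Fin M) → ℝ}
    {h y : EuclideanSpace ℝ (Fin d)} (hne : difference r h (bumpSum w) y ≠ 0) :
    ∃ k ∈ Finset.range (r + 1), ∃ i, w i ≠ 0 ∧ y + (k : ℝ) • h - node i ∈ unitCube d := by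
  by_contra hcon
  refine hne (difference_eq_zero fun k hk => ?_)
  by_contra h0
  exact hcon ⟨k, hk, exists_of_bumpSum_ne_zero h0⟩

theorem volume_preimage_smul_sub {c : ℝ} (hc : 0 < c) (v : EuclideanSpace ℝ (Fin d))
    (S : Set (EuclideanSpace ℝ (Fin d))) :
    volume {x | c • x - v ∈ S} = ENNReal.ofReal ((c ^ d)⁻¹) * volume S := by
  have : {x | c • x - v ∈ S} = (c • ·) ⁻¹' ((· + -v) ⁻¹' S) := by
    simp only [← sub_eq_add_neg]; rfl
  rw [this, Measure.addHaar_preimage_smul _ hc.ne', finrank_euclideanSpace_fin,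
    measure_preimage_add_right, abs_of_pos (by positivity)]

end Bump

/-! ### Besov semi-norm of functions living at scale `1 / M` -/

theorem lintegral_Ioc_rpow {α c : ℝ} (hα : 0 < α) (hc : 0 ≤ c) :
    ∫⁻ t in Ioc 0 c, ENNReal.ofReal (t ^ (α - 1)) = ENNReal.ofReal (c ^ α / α) := by
  have hint : IntegrableOn (fun t : ℝ => t ^ (α - 1)) (Ioc 0 c) :=
    (intervalIntegrable_iff_integrableOn_Ioc_of_le hc).1
      (intervalIntegral.intervalIntegrable_rpow' (by linarith))
  rw [← ofReal_integral_eq_lintegral_ofReal hint, ← intervalIntegral.integral_of_le hc,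
    integral_rpow (Or.inl (by linarith)), sub_add_cancel, Real.zero_rpow hα.ne', sub_zero]
  filter_upwards [ae_restrict_mem measurableSet_Ioc] with t ht
  exact Real.rpow_nonneg ht.1.le _

theorem lintegral_Ioi_rpow {α c : ℝ} (hα : 0 < α) (hc : 0 < c) :
    ∫⁻ t in Ioi c, ENNReal.ofReal (t ^ (-α - 1)) = ENNReal.ofReal (c ^ (-α) / α) := by
  rw [← ofReal_integral_eq_lintegral_ofReal (integrableOn_Ioi_rpow_of_lt (by linarith) hc),
    integral_Ioi_rpow_of_lt (by linarith) hc, sub_add_cancel, div_neg, neg_div, neg_neg]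
  filter_upwards [ae_restrict_mem measurableSet_Ioi] with t ht
  exact Real.rpow_nonneg (hc.trans ht).le _

/-- Since `0 < s < r`, `min 1 (u ^ r) ≤ u ^ s` for every `u > 0`. -/
theorem rpow_neg_mul_min_le {s : ℝ} (hs : 0 < s) {r : ℕ} (hr : s < r) {M t : ℝ} (hM : 0 < M)
    (ht : 0 < t) : t ^ (-s) * min 1 ((M * t) ^ r) ≤ M ^ s := by
  have hu : 0 < M * t := mul_pos hM ht
  have h1 : min 1 ((M * t) ^ r) ≤ (M * t) ^ s := by
    rcases le_total 1 (M * t) with h | h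
    · exact (min_le_left _ _).trans (Real.one_le_rpow h hs.le)
    · refine (min_le_right _ _).trans ?_
      rw [← Real.rpow_natCast]
      exact Real.rpow_le_rpow_of_exponent_ge hu h hr.le
  calc _ ≤ t ^ (-s) * (M * t) ^ s := by gcongr
    _ = M ^ s := by
      rw [Real.mul_rpow hM.le ht.le, mul_left_comm, ← Real.rpow_add ht, neg_add_cancel,
        Real.rpow_zero, mul_one]

/-- The integral is split at `t = 1 / M`. Below, the power `(r - s) T - 1` is integrable at zero
because `s < r`; above, `-s T - 1` is integrable at infinity because `0 < s`. Both pieces scale as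
`M ^ (s T)`. -/
theorem lintegral_scaled_min_le {s T : ℝ} (hs : 0 < s) (hT : 0 < T) {r : ℕ} (hr : s < r) {M : ℝ}
    (hM : 0 < M) :
    ∫⁻ t in Ioc (0 : ℝ) 1, ENNReal.ofReal ((t ^ (-s) * min 1 ((M * t) ^ r)) ^ T * t⁻¹)
      ≤ ENNReal.ofReal (1 / ((r - s) * T) + 1 / (s * T)) * ENNReal.ofReal (M ^ (s * T)) := by
  have hα : 0 < (r - s) * T := mul_pos (sub_pos.2 hr) hT
  have hβ : 0 < s * T := mul_pos hs hT
  have hMi : 0 < M⁻¹ := inv_pos.2 hM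
  have hsub : Ioc (0 : ℝ) 1 ⊆ Ioc 0 M⁻¹ ∪ Ioi M⁻¹ := fun t ht => by
    rcases le_or_gt t M⁻¹ with h | h
    · exact Or.inl ⟨ht.1, h⟩
    · exact Or.inr h
  have hnear : ∫⁻ t in Ioc 0 M⁻¹, ENNReal.ofReal ((t ^ (-s) * min 1 ((M * t) ^ r)) ^ T * t⁻¹)
      ≤ ENNReal.ofReal (1 / ((r - s) * T) * M ^ (s * T)) := by
    calc _ ≤ ∫⁻ t in Ioc 0 M⁻¹,
          ENNReal.ofReal (M ^ (r * T)) * ENNReal.ofReal (t ^ ((r - s) * T - 1)) := by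
          refine setLIntegral_mono' measurableSet_Ioc fun t ht => ?_
          have ht0 : 0 < t := ht.1
          rw [← ENNReal.ofReal_mul (by positivity)]
          refine ENNReal.ofReal_le_ofReal ?_
          calc _ ≤ (t ^ (-s) * (M * t) ^ (r : ℝ)) ^ T * t⁻¹ := by
                rw [Real.rpow_natCast]
                gcongr
                exact min_le_right _ _
            _ = _ := by
                rw [Real.mul_rpow hM.le ht0.le, mul_left_comm, ← Real.rpow_add ht0,
                  Real.mul_rpow (by positivity) (by positivity), ← Real.rpow_mul hM.le,
                  ← Real.rpow_mul ht0.le, Real.rpow_sub_one ht0.ne', neg_add_eq_sub]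
                ring
      _ = _ := by
          rw [lintegral_const_mul' _ _ ENNReal.ofReal_ne_top, lintegral_Ioc_rpow hα hMi.le,
            ← ENNReal.ofReal_mul (by positivity)]
          congr 1
          rw [Real.inv_rpow hM.le, ← Real.rpow_neg hM.le, ← mul_div_assoc, ← Real.rpow_add hM,
            div_mul_eq_mul_div, one_mul]
          congr 2
          ring
  have hfar : ∫⁻ t in Ioi M⁻¹, ENNReal.ofReal ((t ^ (-s) * min 1 ((M * t) ^ r)) ^ T * t⁻¹)
      ≤ ENNReal.ofReal (1 / (s * T) * M ^ (s * T)) := by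
    calc _ ≤ ∫⁻ t in Ioi M⁻¹, ENNReal.ofReal (t ^ (-(s * T) - 1)) := by
          refine setLIntegral_mono' measurableSet_Ioi fun t ht => ?_
          have ht0 : 0 < t := hMi.trans ht
          refine ENNReal.ofReal_le_ofReal ?_
          calc _ ≤ (t ^ (-s) * 1) ^ T * t⁻¹ := by
                gcongr
                exact min_le_left _ _
            _ = _ := by
                rw [mul_one, ← Real.rpow_mul ht0.le, Real.rpow_sub_one ht0.ne', neg_mul,
                  div_eq_mul_inv]
      _ = _ := by
          rw [lintegral_Ioi_rpow hβ hMi, Real.inv_rpow hM.le, ← Real.rpow_neg hM.le, neg_neg,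
            div_mul_eq_mul_div, one_mul]
  calc _ ≤ _ := lintegral_mono_set hsub
    _ ≤ _ := lintegral_union_le _ _ _
    _ ≤ _ := add_le_add hnear hfar
    _ = _ := by
      rw [← ENNReal.ofReal_add (by positivity) (by positivity),
        ← ENNReal.ofReal_mul (by positivity), add_mul]

/-- A function whose modulus of smoothness saturates at scale `1 / M` has Besov semi-norm of
order `M ^ s`. -/
theorem exists_besovSeminorm_le {s : ℝ} (hs : 0 < s) (p : ℝ≥0∞) {τ : ℝ≥0∞} (hτ : 0 < τ) :
    ∃ K : ℝ, 0 ≤ K ∧ ∀ {d : ℕ} (f : EuclideanSpace ℝ (Fin d) → ℝ) (D : ℝ≥0∞) (M : ℝ), 0 < M →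
      (∀ t ∈ Ioc (0 : ℝ) 1,
        modulus (⌊s⌋₊ + 1) p f t ≤ D * ENNReal.ofReal (min 1 ((M * t) ^ (⌊s⌋₊ + 1)))) →
      besovSeminorm s p τ f ≤ D * ENNReal.ofReal (K * M ^ s) := by
  have hr : s < ((⌊s⌋₊ + 1 : ℕ) : ℝ) := by push_cast; exact Nat.lt_floor_add_one s
  set r := ⌊s⌋₊ + 1
  have hscale : ∀ {d : ℕ} (f : EuclideanSpace ℝ (Fin d) → ℝ) (D : ℝ≥0∞) (M : ℝ),
      (∀ t ∈ Ioc (0 : ℝ) 1, modulus r p f t ≤ D * ENNReal.ofReal (min 1 ((M * t) ^ r))) →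
      ∀ t ∈ Ioc (0 : ℝ) 1, ENNReal.ofReal (t ^ (-s)) * modulus r p f t
        ≤ D * ENNReal.ofReal (t ^ (-s) * min 1 ((M * t) ^ r)) := by
    intro d f D M h t ht
    rw [ENNReal.ofReal_mul (Real.rpow_nonneg ht.1.le _), mul_left_comm]
    gcongr
    exact h t ht
  by_cases htop : τ = ∞
  · refine ⟨1, zero_le_one, fun {d} f D M hM h => ?_⟩
    rw [besovSeminorm, if_pos htop]
    refine iSup₂_le fun t ht => (hscale f D M h t ht).trans ?_
    refine mul_le_mul' le_rfl (ENNReal.ofReal_le_ofReal ?_)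
    rw [one_mul]
    exact rpow_neg_mul_min_le hs hr hM ht.1
  · have hT : 0 < τ.toReal := ENNReal.toReal_pos hτ.ne' htop
    set T := τ.toReal
    set K₁ : ℝ := 1 / ((r - s) * T) + 1 / (s * T)
    have hK₁ : 0 ≤ K₁ := by
      have := sub_pos.2 hr
      positivity
    refine ⟨K₁ ^ T⁻¹, by positivity, fun {d} f D M hM h => ?_⟩
    rw [besovSeminorm, if_neg htop]
    have hmeas : Measurable fun t : ℝ =>
        ENNReal.ofReal ((t ^ (-s) * min 1 ((M * t) ^ r)) ^ T * t⁻¹) := by fun_prop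
    calc _ ≤ (∫⁻ t in Ioc (0 : ℝ) 1, D ^ T *
          ENNReal.ofReal ((t ^ (-s) * min 1 ((M * t) ^ r)) ^ T * t⁻¹)) ^ T⁻¹ := by
          refine ENNReal.rpow_le_rpow (setLIntegral_mono' measurableSet_Ioc fun t ht => ?_)
            (by positivity)
          have ht0 : 0 < t := ht.1
          have hnn : 0 ≤ t ^ (-s) * min 1 ((M * t) ^ r) :=
            mul_nonneg (by positivity) (le_min zero_le_one (by positivity))
          rw [ENNReal.ofReal_mul (Real.rpow_nonneg hnn _), ← mul_assoc,
            ← ENNReal.ofReal_rpow_of_nonneg hnn hT.le, ← ENNReal.mul_rpow_of_nonneg _ _ hT.le]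
          exact mul_le_mul' (ENNReal.rpow_le_rpow (hscale f D M h t ht) hT.le) le_rfl
      _ ≤ (D ^ T * (ENNReal.ofReal K₁ * ENNReal.ofReal (M ^ (s * T)))) ^ T⁻¹ := by
          rw [lintegral_const_mul _ hmeas]
          gcongr
          exact lintegral_scaled_min_le hs hT hr hM
      _ = _ := by
          rw [ENNReal.mul_rpow_of_nonneg _ _ (by positivity), ENNReal.rpow_rpow_inv hT.ne',
            ← ENNReal.ofReal_mul hK₁, ENNReal.ofReal_rpow_of_nonneg (by positivity) (by positivity),
            Real.mul_rpow hK₁ (by positivity), ← Real.rpow_mul hM.le,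
            mul_inv_cancel_right₀ hT.ne']

/-! ### Bump sums in the Besov ball -/

section

variable {d : ℕ}

/-- A union bound over `(r + 1) |S|` translated cells of volume `M ^ (-d)`; the set contains every
point where the rescaled difference can be nonzero. -/
theorem volume_shifted_cells_le {M : ℕ} (hM : 1 ≤ M) (S : Finset (Fin d → Fin M)) (r : ℕ)
    (h : EuclideanSpace ℝ (Fin d)) :
    volume {x : EuclideanSpace ℝ (Fin d) | ∃ k ∈ Finset.range (r + 1), ∃ i ∈ S,
        (M : ℝ) • x + (k : ℝ) • h - node i ∈ unitCube d}
      ≤ ENNReal.ofReal ((r + 1) * (S.card / (M : ℝ) ^ d)) := by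
  have hM0 : (0 : ℝ) < M := by exact_mod_cast hM
  have hset : {x : EuclideanSpace ℝ (Fin d) | ∃ k ∈ Finset.range (r + 1), ∃ i ∈ S,
      (M : ℝ) • x + (k : ℝ) • h - node i ∈ unitCube d}
      = ⋃ k ∈ Finset.range (r + 1), ⋃ i ∈ S,
        {x | (M : ℝ) • x - (node i - (k : ℝ) • h) ∈ unitCube d} := by
    ext x
    simp only [mem_iUnion, mem_ofPred_eq, exists_prop]
    simp only [sub_sub_eq_add_sub]
  rw [hset]
  calc _ ≤ ∑ k ∈ Finset.range (r + 1), ∑ i ∈ S,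
        volume {x | (M : ℝ) • x - (node i - (k : ℝ) • h) ∈ unitCube d} :=
        (measure_biUnion_finset_le _ _).trans
          (Finset.sum_le_sum fun k _ => measure_biUnion_finset_le _ _)
    _ = _ := by
        simp only [volume_preimage_smul_sub hM0, volume_unitCube, mul_one, Finset.sum_const,
          Finset.card_range, nsmul_eq_mul]
        rw [ENNReal.ofReal_mul (by positivity), div_eq_mul_inv,
          ENNReal.ofReal_mul (Nat.cast_nonneg _), ENNReal.ofReal_natCast, ← Nat.cast_succ,
          ENNReal.ofReal_natCast]

/-- The difference is at most `a * B` and vanishes off the translated cells. The exponent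
`(p⁻¹).toReal` is zero for `p = ∞`, so no case distinction is needed. -/
theorem eLpNorm_difference_bumpSum_le {M : ℕ} (hM : 1 ≤ M) {S : Finset (Fin d → Fin M)}
    {w : (Fin d → Fin M) → ℝ} (hS : ∀ i, i ∉ S → w i = 0) {a B : ℝ} (ha : 0 ≤ a) (r : ℕ)
    {h : EuclideanSpace ℝ (Fin d)}
    (hB : ∀ y, |difference r ((M : ℝ) • h) (bumpSum w) y| ≤ B) (p : ℝ≥0∞)
    (A : Set (EuclideanSpace ℝ (Fin d))) :
    eLpNorm (difference r h fun x => a * bumpSum w ((M : ℝ) • x)) p (volume.restrict A)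
      ≤ ENNReal.ofReal (a * B * ((r + 1) * (S.card / (M : ℝ) ^ d)) ^ (p⁻¹).toReal) := by
  set T := {x : EuclideanSpace ℝ (Fin d) | ∃ k ∈ Finset.range (r + 1), ∃ i ∈ S,
    (M : ℝ) • x + (k : ℝ) • (M : ℝ) • h - node i ∈ unitCube d}
  have hB0 : 0 ≤ B := (abs_nonneg _).trans (hB 0)
  calc _ ≤ eLpNorm (T.indicator fun _ => a * B) p (volume.restrict A) := by
        refine eLpNorm_mono_real fun x => ?_
        rw [difference_comp_smul, Real.norm_eq_abs, abs_mul, abs_of_nonneg ha]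
        by_cases hx : difference r ((M : ℝ) • h) (bumpSum w) ((M : ℝ) • x) = 0
        · rw [hx, abs_zero, mul_zero]
          exact indicator_nonneg (fun _ _ => mul_nonneg ha hB0) _
        · obtain ⟨k, hk, i, hi, hmem⟩ := exists_of_difference_bumpSum_ne_zero hx
          have hxT : x ∈ T := ⟨k, hk, i, by_contra fun hn => hi (hS i hn), hmem⟩
          rw [indicator_of_mem hxT]
          gcongr
          exact hB _
    _ ≤ ‖a * B‖ₑ * (volume.restrict A) T ^ (1 / p.toReal) := eLpNorm_indicator_const_le _ _
    _ ≤ ENNReal.ofReal (a * B) *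
          ENNReal.ofReal ((r + 1) * (S.card / (M : ℝ) ^ d)) ^ (1 / p.toReal) := by
        rw [Real.enorm_eq_ofReal (mul_nonneg ha hB0)]
        gcongr
        exact (Measure.restrict_apply_le _ _).trans (volume_shifted_cells_le hM S r _)
    _ = _ := by
        rw [ENNReal.ofReal_rpow_of_nonneg (by positivity) (by positivity),
          ← ENNReal.ofReal_mul (mul_nonneg ha hB0), one_div, ENNReal.toReal_inv]

/-- Normalised bump combinations belong to the Besov ball; `ρ` below is the relative volume of the
cells that carry the combination. -/
theorem exists_bumpSum_mem_besovBall (d : ℕ) {s : ℝ} (hs : 0 < s) (p : ℝ≥0∞) {τ : ℝ≥0∞}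
    (hτ : 0 < τ) :
    ∃ c : ℝ, 0 < c ∧ c ≤ 1 / 2 ∧ ∀ (M : ℕ), 1 ≤ M → ∀ (w : (Fin d → Fin M) → ℝ)
      (S : Finset (Fin d → Fin M)), (∀ i, |w i| ≤ 1) → (∀ i, i ∉ S → w i = 0) → S.Nonempty →
      (fun x => c * (M : ℝ) ^ (-s) * ((S.card : ℝ) / (M : ℝ) ^ d) ^ (-(p⁻¹).toReal)
        * bumpSum w ((M : ℝ) • x)) ∈ besovBall d s p τ := by
  set r := ⌊s⌋₊ + 1
  set P := (p⁻¹).toReal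
  obtain ⟨C, hC0, hC⟩ := exists_abs_difference_bump_le d r
  obtain ⟨K, hK0, hK⟩ := exists_besovSeminorm_le hs p hτ
  set C' : ℝ := (r + 1) * C * (r + 1) ^ P * K
  have hC' : 0 ≤ C' := by positivity
  have hden : 0 < 2 + C' := by positivity
  -- The norm is at most `c + c * C'`. The summand `2` ensures `c ≤ 1 / 2`, used later to keep the
  -- sign flips hidden.
  refine ⟨1 / (2 + C'), by positivity, by gcongr; linarith, fun M hM w S hw hS hSne => ?_⟩
  set c := 1 / (2 + C')
  have hM0 : (0 : ℝ) < M := by exact_mod_cast hM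
  have hcard : (0 : ℝ) < S.card := by exact_mod_cast hSne.card_pos
  set ρ : ℝ := S.card / (M : ℝ) ^ d
  have hρ : 0 < ρ := by positivity
  set a := c * (M : ℝ) ^ (-s) * ρ ^ (-P)
  have ha : 0 < a := by positivity
  have haρ : a * ρ ^ P = c * (M : ℝ) ^ (-s) := by
    simp only [a]
    rw [mul_assoc, ← Real.rpow_add hρ, neg_add_cancel, Real.rpow_zero, mul_one]
  have hcont : Continuous fun x => a * bumpSum w ((M : ℝ) • x) :=
    continuous_const.mul ((continuous_bumpSum w).comp (continuous_const_smul _))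
  refine ⟨hcont.continuousOn, ?_⟩
  have hnorm : eLpNorm (fun x => a * bumpSum w ((M : ℝ) • x)) p (cubeMeasure d)
      ≤ ENNReal.ofReal c := by
    have h0 : ∀ g : EuclideanSpace ℝ (Fin d) → ℝ, difference 0 0 g = g := fun g => by
      funext x; simp [difference]
    -- A difference of order zero is the function itself, so the same estimate covers the `L_p`
    -- norm.
    have := eLpNorm_difference_bumpSum_le hM hS ha.le 0 (h := 0) (B := 1)
      (fun y => by rw [smul_zero, h0]; exact abs_bumpSum_le_one hw y) p (unitCube d)
    rw [h0] at this
    refine this.trans (ENNReal.ofReal_le_ofReal ?_)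
    rw [mul_one, Nat.cast_zero, zero_add, one_mul, haρ]
    refine mul_le_of_le_one_right (by positivity) ?_
    exact Real.rpow_le_one_of_one_le_of_nonpos (by exact_mod_cast hM) (by linarith)
  have hsemi : besovSeminorm s p τ (fun x => a * bumpSum w ((M : ℝ) • x))
      ≤ ENNReal.ofReal (c * C') := by
    refine (hK _ (ENNReal.ofReal (a * ((r + 1) * C) * ((r + 1) * ρ) ^ P)) M hM0
      fun t ht => iSup₂_le fun h hh => ?_).trans_eq ?_
    · refine (eLpNorm_difference_bumpSum_le hM hS ha.le r
        (B := (r + 1) * C * min 1 ((M * t) ^ r)) (fun y => ?_) p _).trans_eq ?_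
      · refine (abs_difference_bumpSum_le hC0 hC hw _ y).trans ?_
        gcongr
        rw [norm_smul, Real.norm_of_nonneg hM0.le]
        gcongr
      · rw [← ENNReal.ofReal_mul (by positivity)]
        congr 1
        ring
    · rw [← ENNReal.ofReal_mul (by positivity)]
      congr 1
      rw [Real.mul_rpow (by positivity) hρ.le]
      calc _ = (a * ρ ^ P) * (M : ℝ) ^ s * C' := by ring
        _ = _ := by
          rw [haρ, mul_assoc c, ← Real.rpow_add hM0, neg_add_cancel, Real.rpow_zero, mul_one]
  refine (add_le_add hnorm hsemi).trans ?_
  rw [← ENNReal.ofReal_add (by positivity) (by positivity)]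
  refine ENNReal.ofReal_le_one.2 ?_
  rw [← mul_one_add, one_div_mul_eq_div, div_le_one hden]
  linarith

end

/-! ### Fooling functions and the noise-free rate -/

variable {d : ℕ}

theorem le_minimaxRisk {K : Set (EuclideanSpace ℝ (Fin d) → ℝ)} {m : ℕ} {σ : ℝ≥0} {q B : ℝ≥0∞}
    (h : ∀ (x : Fin m → EuclideanSpace ℝ (Fin d)) (A : (Fin m → ℝ) → Lp ℝ q (cubeMeasure d)),
      B ≤ algorithmRisk K σ q x A) : B ≤ minimaxRisk K m σ q :=
  le_iInf fun x => le_iInf fun _ => le_iInf fun _ => le_iInf fun A => h x A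

theorem upperIntegral_le_algorithmRisk {m : ℕ} {K : Set (EuclideanSpace ℝ (Fin d) → ℝ)}
    {σ : ℝ≥0} {q : ℝ≥0∞} {x : Fin m → EuclideanSpace ℝ (Fin d)}
    {A : (Fin m → ℝ) → Lp ℝ q (cubeMeasure d)} {f : EuclideanSpace ℝ (Fin d) → ℝ} (hf : f ∈ K) :
    upperIntegral (noiseLaw m σ) (fun η =>
      eLpNorm (fun z => f z - A (fun i => f (x i) + η i) z) q (cubeMeasure d))
      ≤ algorithmRisk K σ q x A :=
  le_iSup₂_of_le f hf le_rfl

theorem mem_unitCube_of_mem_cell {M : ℕ} (hM : 1 ≤ M) {i : Fin d → Fin M}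
    {x : EuclideanSpace ℝ (Fin d)} (h : (M : ℝ) • x - node i ∈ unitCube d) : x ∈ unitCube d := by
  intro k
  have hM0 : (0 : ℝ) < M := by exact_mod_cast hM
  have hk : (M : ℝ) * x k - (i k : ℕ) ∈ Ioo (0 : ℝ) 1 := h k
  have hi : ((i k : ℕ) : ℝ) + 1 ≤ M := by exact_mod_cast (i k).isLt
  have hi0 : (0 : ℝ) ≤ (i k : ℕ) := Nat.cast_nonneg _
  constructor
  · exact pos_of_mul_pos_right (by linarith [hk.1]) hM0.le
  · exact lt_of_mul_lt_mul_left (by linarith [hk.2]) hM0.le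

/-- The ball on which the bump equals one. -/
def bumpTop (d : ℕ) : Set (EuclideanSpace ℝ (Fin d)) := Metric.ball (cubeCenter d) (1 / 8)

theorem bump_eq_one {x : EuclideanSpace ℝ (Fin d)} (h : x ∈ bumpTop d) : bump d x = 1 :=
  (bump d).one_of_mem_closedBall (Metric.ball_subset_closedBall h)

theorem bumpTop_subset (d : ℕ) : bumpTop d ⊆ unitCube d := fun x hx =>
  mem_unitCube_of_bump_ne_zero (by rw [bump_eq_one hx]; exact one_ne_zero)

theorem exists_volume_bumpTop (d : ℕ) :
    ∃ v : ℝ, 0 < v ∧ v ≤ 1 ∧ volume (bumpTop d) = ENNReal.ofReal v := by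
  have h1 : volume (bumpTop d) ≤ 1 := (measure_mono (bumpTop_subset d)).trans_eq (volume_unitCube d)
  have hfin : volume (bumpTop d) ≠ ∞ := ne_top_of_le_ne_top ENNReal.one_ne_top h1
  have hpos : 0 < volume (bumpTop d) := Metric.measure_ball_pos _ _ (by norm_num)
  exact ⟨(volume (bumpTop d)).toReal, ENNReal.toReal_pos hpos.ne' hfin,
    ENNReal.toReal_le_of_le_ofReal zero_le_one (by simpa using h1), (ENNReal.ofReal_toReal hfin).symm⟩

theorem measurableSet_preimage_smul_sub (c : ℝ) (v : EuclideanSpace ℝ (Fin d))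
    {S : Set (EuclideanSpace ℝ (Fin d))} (hS : IsOpen S) :
    MeasurableSet {x : EuclideanSpace ℝ (Fin d) | c • x - v ∈ S} :=
  (hS.preimage (f := fun x => c • x - v) (by fun_prop)).measurableSet

/-- The sum equals `a` on the disjoint plateaus of its bumps, whose total volume is `v |S| / M ^ d`.
-/
theorem le_eLpNorm_bumpSum {M : ℕ} (hM : 1 ≤ M) {S : Finset (Fin d → Fin M)} (hSne : S.Nonempty)
    {w : (Fin d → Fin M) → ℝ} (hw : ∀ i ∈ S, w i = 1) {v : ℝ} (hv0 : 0 < v)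
    (hv : volume (bumpTop d) = ENNReal.ofReal v) {a : ℝ} (ha : 0 ≤ a) {q : ℝ≥0∞} (hq : q ≠ 0) :
    ENNReal.ofReal (a * (v * (S.card / (M : ℝ) ^ d)) ^ (q⁻¹).toReal)
      ≤ eLpNorm (fun x => a * bumpSum w ((M : ℝ) • x)) q (cubeMeasure d) := by
  have hM0 : (0 : ℝ) < M := by exact_mod_cast hM
  have hcard : (0 : ℝ) < S.card := by exact_mod_cast hSne.card_pos
  set T : (Fin d → Fin M) → Set (EuclideanSpace ℝ (Fin d)) := fun i =>
    {x | (M : ℝ) • x - node i ∈ bumpTop d}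
  have hTm : ∀ i, MeasurableSet (T i) := fun i =>
    measurableSet_preimage_smul_sub _ _ Metric.isOpen_ball
  have hTU : ∀ i, T i ⊆ unitCube d := fun i x hx =>
    mem_unitCube_of_mem_cell hM (bumpTop_subset d hx)
  have hUm : MeasurableSet (⋃ i ∈ S, T i) := Finset.measurableSet_biUnion _ fun i _ => hTm i
  have hvol : cubeMeasure d (⋃ i ∈ S, T i) = ENNReal.ofReal (v * (S.card / (M : ℝ) ^ d)) := by
    rw [Measure.restrict_apply hUm, inter_eq_left.2 (iUnion₂_subset fun i _ => hTU i),
      measure_biUnion_finset _ fun i _ => hTm i]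
    · simp only [T, volume_preimage_smul_sub hM0, hv, Finset.sum_const, nsmul_eq_mul]
      rw [← ENNReal.ofReal_mul (by positivity), ← ENNReal.ofReal_natCast,
        ← ENNReal.ofReal_mul (by positivity)]
      congr 1
      ring
    · intro i _ j _ hij
      refine Set.disjoint_left.2 fun x hi hj => hij ?_
      exact node_eq_of_mem (bumpTop_subset d hi) (bumpTop_subset d hj)
  have hne : cubeMeasure d (⋃ i ∈ S, T i) ≠ 0 := by
    rw [hvol]
    exact (ENNReal.ofReal_pos.2 (by positivity)).ne'
  calc _ = eLpNorm ((⋃ i ∈ S, T i).indicator fun _ => a) q (cubeMeasure d) := by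
        rw [eLpNorm_indicator_const' hUm hne hq, hvol, Real.enorm_eq_ofReal ha,
          ENNReal.ofReal_rpow_of_nonneg (by positivity) (by positivity),
          ← ENNReal.ofReal_mul ha, one_div, ENNReal.toReal_inv]
    _ ≤ _ := by
        refine eLpNorm_mono fun x => ?_
        by_cases hx : x ∈ ⋃ i ∈ S, T i
        · rw [indicator_of_mem hx]
          obtain ⟨i, hi, hxi⟩ := mem_iUnion₂.1 hx
          rw [bumpSum_eq_of_mem w (bumpTop_subset d hxi), hw i hi, bump_eq_one hxi, mul_one, mul_one]
        · rw [indicator_of_notMem hx, norm_zero]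
          exact norm_nonneg _

open scoped Classical in
theorem sum_data_in_cells_le {m M : ℕ} (x : Fin m → EuclideanSpace ℝ (Fin d)) :
    ∑ i : Fin d → Fin M, ∑ j, (if (M : ℝ) • x j - node i ∈ unitCube d then (1 : ℝ) else 0) ≤ m := by
  rw [Finset.sum_comm]
  calc _ ≤ ∑ _j : Fin m, (1 : ℝ) :=
        Finset.sum_le_sum fun j _ => sum_indicator_unitCube_le_one _
    _ = m := by simp

/-- If there are at least twice as many cells as data sites, half of the cells are empty. -/
theorem exists_empty_cells {m M : ℕ} (h : 2 * (m : ℝ) ≤ (M : ℝ) ^ d)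
    (x : Fin m → EuclideanSpace ℝ (Fin d)) :
    ∃ S : Finset (Fin d → Fin M), (∀ i ∈ S, ∀ j, (M : ℝ) • x j - node i ∉ unitCube d) ∧
      (M : ℝ) ^ d ≤ 2 * S.card := by
  classical
  refine ⟨Finset.univ.filter fun i => ∀ j, (M : ℝ) • x j - node i ∉ unitCube d,
    fun i hi => (Finset.mem_filter.1 hi).2, ?_⟩
  set S : Finset (Fin d → Fin M) :=
    Finset.univ.filter fun i => ∀ j, (M : ℝ) • x j - node i ∉ unitCube d
  have hone : ∀ i ∈ Sᶜ, (1 : ℝ) ≤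
      ∑ j, (if (M : ℝ) • x j - node i ∈ unitCube d then (1 : ℝ) else 0) := by
    intro i hi
    simp only [S, Finset.mem_compl, Finset.mem_filter, Finset.mem_univ, true_and, not_forall,
      not_not] at hi
    obtain ⟨j, hj⟩ := hi
    refine le_trans (by rw [if_pos hj]) (Finset.single_le_sum (f := fun j =>
      if (M : ℝ) • x j - node i ∈ unitCube d then (1 : ℝ) else 0) (fun j _ => ?_)
      (Finset.mem_univ j))
    split_ifs <;> norm_num
  have hc : ((Sᶜ).card : ℝ) ≤ m := by
    calc ((Sᶜ).card : ℝ) = ∑ i ∈ Sᶜ, (1 : ℝ) := by simp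
      _ ≤ _ := Finset.sum_le_sum hone
      _ ≤ _ := Finset.sum_le_univ_sum_of_nonneg fun i =>
          Finset.sum_nonneg fun j _ => by split_ifs <;> norm_num
      _ ≤ m := sum_data_in_cells_le x
  have htot : (S.card : ℝ) + (Sᶜ).card = (M : ℝ) ^ d := by
    have := Finset.card_add_card_compl S
    rw [Fintype.card_fun, Fintype.card_fin, Fintype.card_fin] at this
    exact_mod_cast this
  linarith

/-- The fooling function argument: a class containing `f` and `-f`, where `f` vanishes at the data
sites, cannot be recovered better than up to `‖f‖`. -/
theorem eLpNorm_le_algorithmRisk {m : ℕ} {K : Set (EuclideanSpace ℝ (Fin d) → ℝ)} {σ : ℝ≥0}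
    {q : ℝ≥0∞} (hq : 1 ≤ q) {x : Fin m → EuclideanSpace ℝ (Fin d)}
    (A : (Fin m → ℝ) → Lp ℝ q (cubeMeasure d)) {f : EuclideanSpace ℝ (Fin d) → ℝ}
    (hcont : Continuous f) (hf : f ∈ K) (hf' : (fun z => -f z) ∈ K) (h0 : ∀ j, f (x j) = 0) :
    eLpNorm f q (cubeMeasure d) ≤ algorithmRisk K σ q x A := by
  refine two_point_bound (fun η => ?_) (upperIntegral_le_algorithmRisk (A := A) (σ := σ) hf)
    (upperIntegral_le_algorithmRisk (A := A) (σ := σ) hf')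
  simp only [h0, neg_zero, zero_add]
  set g : Lp ℝ q (cubeMeasure d) := A fun i => η i
  have hfm : AEStronglyMeasurable f (cubeMeasure d) := hcont.aestronglyMeasurable
  have hgm : AEStronglyMeasurable g (cubeMeasure d) := Lp.aestronglyMeasurable g
  -- Both signs of `f` yield the pure noise as data and thus the same reconstruction `g`; the
  -- triangle inequality in `L_q` makes the two errors add up to at least `2 ‖f‖`.
  have heq : (2 : ℝ) • f = (fun z => f z - g z) - fun z => -f z - g z := by
    funext z; simp; ring
  calc 2 * eLpNorm f q (cubeMeasure d) = eLpNorm ((2 : ℝ) • f) q (cubeMeasure d) := by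
        rw [eLpNorm_const_smul, Real.enorm_eq_ofReal zero_le_two, ENNReal.ofReal_ofNat]
    _ ≤ _ := by
        rw [heq]
        exact eLpNorm_sub_le (hfm.sub hgm) (hfm.neg.sub hgm) hq

theorem exists_deterministic_bound (hd : 1 ≤ d) {s : ℝ} (hs : 0 < s) {p τ q : ℝ≥0∞} (hτ : 0 < τ)
    (hq : 1 ≤ q) (hsp : (d : ℝ) * (p⁻¹).toReal < s) :
    ∃ C : ℝ, 0 < C ∧ ∀ (m : ℕ) (σ : ℝ≥0), 1 ≤ m →
      ENNReal.ofReal (C * (m : ℝ) ^ (-(s / d) + max ((p⁻¹).toReal - (q⁻¹).toReal) 0))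
        ≤ minimaxRisk (besovBall d s p τ) m σ q := by
  classical
  obtain ⟨c, hc0, -, hc⟩ := exists_bumpSum_mem_besovBall d hs p hτ
  obtain ⟨v, hv0, hv1, hv⟩ := exists_volume_bumpTop d
  set P := (p⁻¹).toReal
  set Q := (q⁻¹).toReal
  have hQ : 0 ≤ Q := ENNReal.toReal_nonneg
  have hP : 0 ≤ P := ENNReal.toReal_nonneg
  have hd0 : (0 : ℝ) < d := by exact_mod_cast hd
  -- The target rate is `M ^ e`. The embedding condition `d / p < s` gives `e ≤ 0`, so an upper
  -- bound on `M` suffices to compare with powers of `m`.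
  set e : ℝ := -s + d * max (P - Q) 0
  have he : e ≤ 0 := by
    have : d * max (P - Q) 0 ≤ d * P :=
      mul_le_mul_of_nonneg_left (max_le (by linarith) hP) hd0.le
    linarith
  refine ⟨c * (v / 2) ^ Q * 4 ^ e, by positivity, fun m σ hm => le_minimaxRisk fun x A => ?_⟩
  have hm1 : (1 : ℝ) ≤ m := by exact_mod_cast hm
  have hm0 : (0 : ℝ) < m := by linarith
  have hmd : 1 ≤ (m : ℝ) ^ (1 / (d : ℝ)) := Real.one_le_rpow hm1 (by positivity)
  -- The factor `2` gives `M ^ d ≥ 2 ^ d m ≥ 2 m`; since `m ≥ 1`, rounding up costs at most another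
  -- factor `2`, whence the constant `4 ^ e`.
  set M : ℕ := 2 * ⌈(m : ℝ) ^ (1 / (d : ℝ))⌉₊
  have hMge : 2 * (m : ℝ) ^ (1 / (d : ℝ)) ≤ M := by
    simp only [M]; push_cast; gcongr; exact Nat.le_ceil _
  have hMle : (M : ℝ) ≤ 4 * (m : ℝ) ^ (1 / (d : ℝ)) := by
    have := Nat.ceil_lt_add_one (zero_le_one.trans hmd)
    simp only [M]; push_cast; linarith
  have hM0 : (0 : ℝ) < M := by linarith
  have hM : 1 ≤ M := by exact_mod_cast hM0
  have h2m : 2 * (m : ℝ) ≤ (M : ℝ) ^ d := by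
    calc 2 * (m : ℝ) ≤ 2 ^ d * m := by
          gcongr
          exact le_self_pow₀ one_le_two (by omega)
      _ = (2 * (m : ℝ) ^ (1 / (d : ℝ))) ^ d := by
          rw [mul_pow, ← Real.rpow_natCast (_ ^ _), ← Real.rpow_mul hm0.le,
            one_div_mul_cancel hd0.ne', Real.rpow_one]
      _ ≤ _ := by gcongr
  have hMe : 4 ^ e * (m : ℝ) ^ (-(s / d) + max (P - Q) 0) ≤ (M : ℝ) ^ e := by
    calc _ = (4 * (m : ℝ) ^ (1 / (d : ℝ))) ^ e := by
          rw [Real.mul_rpow (by norm_num) (by positivity), ← Real.rpow_mul hm0.le]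
          congr 2
          simp only [e]
          field_simp
      _ ≤ _ := Real.rpow_le_rpow_of_nonpos hM0 hMle he
  have main : ∀ S : Finset (Fin d → Fin M), S.Nonempty →
      (∀ i ∈ S, ∀ j, (M : ℝ) • x j - node i ∉ unitCube d) →
      ENNReal.ofReal (c * (M : ℝ) ^ (-s) * ((S.card : ℝ) / (M : ℝ) ^ d) ^ (-P)
        * (v * (S.card / (M : ℝ) ^ d)) ^ Q) ≤ algorithmRisk (besovBall d s p τ) σ q x A := by
    intro S hSne hSe
    set a := c * (M : ℝ) ^ (-s) * ((S.card : ℝ) / (M : ℝ) ^ d) ^ (-P)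
    have ha : 0 ≤ a := by positivity
    set w : (Fin d → Fin M) → ℝ := fun i => if i ∈ S then 1 else 0
    have hwS : ∀ i ∈ S, w i = 1 := fun i hi => if_pos hi
    have hw0 : ∀ i, i ∉ S → w i = 0 := fun i hi => if_neg hi
    have hw1 : ∀ i, |w i| ≤ 1 := fun i => by
      simp only [w]; split_ifs <;> simp
    refine (le_eLpNorm_bumpSum hM hSne hwS hv0 hv ha (zero_lt_one.trans_le hq).ne').trans ?_
    refine eLpNorm_le_algorithmRisk hq A
      (continuous_const.mul ((continuous_bumpSum w).comp (continuous_const_smul _)))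
      (hc M hM w S hw1 hw0 hSne) ?_ fun j => ?_
    · have := hc M hM (fun i => -w i) S (fun i => by rw [abs_neg]; exact hw1 i)
        (fun i hi => by rw [hw0 i hi, neg_zero]) hSne
      convert this using 2 with z
      simp only [bumpSum, neg_mul, Finset.sum_neg_distrib, mul_neg]
      rfl
    · refine mul_eq_zero_of_right _ ?_
      by_contra hne
      obtain ⟨i, hi, hmem⟩ := exists_of_bumpSum_ne_zero hne
      exact hSe i (by_contra fun hn => hi (hw0 i hn)) j hmem
  obtain ⟨S, hSe, hScard⟩ := exists_empty_cells h2m x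
  have hSpos : (0 : ℝ) < S.card := by
    have : (0 : ℝ) < (M : ℝ) ^ d := by positivity
    linarith
  have hSne : S.Nonempty := Finset.card_pos.1 (by exact_mod_cast hSpos)
  have hreduce : ENNReal.ofReal (c * (v / 2) ^ Q * 4 ^ e *
      (m : ℝ) ^ (-(s / d) + max (P - Q) 0)) ≤ ENNReal.ofReal (c * (v / 2) ^ Q * (M : ℝ) ^ e) := by
    refine ENNReal.ofReal_le_ofReal ?_
    rw [mul_assoc (c * (v / 2) ^ Q)]
    gcongr
  refine hreduce.trans ?_
  -- The bound is proportional to `ρ ^ (Q - P)`: all empty cells, with `1/2 ≤ ρ ≤ 1`, if `P ≤ Q`,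
  -- and one cell, with `ρ = M ^ (-d)`, otherwise.
  rcases le_total P Q with hPQ | hPQ
  · refine (ENNReal.ofReal_le_ofReal ?_).trans (main S hSne hSe)
    have he' : e = -s := by simp only [e]; rw [max_eq_right (by linarith)]; ring
    have hρ1 : (S.card : ℝ) / (M : ℝ) ^ d ≤ 1 := by
      rw [div_le_one (by positivity)]
      have := Finset.card_le_univ S
      rw [Fintype.card_fun, Fintype.card_fin, Fintype.card_fin] at this
      exact_mod_cast this
    have hρ2 : 1 / 2 ≤ (S.card : ℝ) / (M : ℝ) ^ d := by
      rw [le_div_iff₀ (by positivity)]; linarith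
    have hone : 1 ≤ ((S.card : ℝ) / (M : ℝ) ^ d) ^ (-P) :=
      Real.one_le_rpow_of_pos_of_le_one_of_nonpos (by positivity) hρ1 (by linarith)
    calc c * (v / 2) ^ Q * (M : ℝ) ^ e = c * (M : ℝ) ^ (-s) * 1 * (v * (1 / 2)) ^ Q := by
          rw [he']; ring_nf
      _ ≤ _ := by gcongr
  · obtain ⟨i, hi⟩ := hSne
    refine (ENNReal.ofReal_le_ofReal ?_).trans
      (main {i} (Finset.singleton_nonempty i) fun k hk => by
        rw [Finset.mem_singleton.1 hk]; exact hSe i hi)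
    have he' : e = -s + d * P + -(d * Q) := by
      simp only [e]; rw [max_eq_left (by linarith)]; ring
    have hpow : ∀ t : ℝ, (1 / (M : ℝ) ^ d) ^ t = (M : ℝ) ^ (-(d * t)) := fun t => by
      rw [one_div, ← Real.rpow_natCast, ← Real.rpow_neg hM0.le, ← Real.rpow_mul hM0.le, neg_mul]
    rw [Finset.card_singleton, Nat.cast_one, Real.mul_rpow hv0.le (by positivity), hpow, hpow,
      he', Real.rpow_add hM0, Real.rpow_add hM0, mul_neg, neg_neg]
    calc c * (v / 2) ^ Q * ((M : ℝ) ^ (-s) * (M : ℝ) ^ (d * P) * (M : ℝ) ^ (-(d * Q)))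
        ≤ c * v ^ Q * ((M : ℝ) ^ (-s) * (M : ℝ) ^ (d * P) * (M : ℝ) ^ (-(d * Q))) := by
          gcongr
          linarith
      _ = _ := by ring

/-! ### Hidden signs and the noise rate -/

/-- The lower bound from testing the signs of bumps on all cells of a grid of resolution `M`, when
the noise hides these signs. -/
theorem exists_bound_of_hidden_signs (d : ℕ) {s : ℝ} (hs : 0 < s) (p : ℝ≥0∞) {τ q : ℝ≥0∞}
    (hτ : 0 < τ) (hq : 1 ≤ q) :
    ∃ C : ℝ, 0 < C ∧ ∀ (m M : ℕ) (σ : ℝ≥0), 1 ≤ M → σ ≠ 0 →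
      (m : ℝ) * (M : ℝ) ^ (-(2 * s)) ≤ (σ : ℝ) ^ 2 * (M : ℝ) ^ d →
      ENNReal.ofReal (C * (M : ℝ) ^ (-s)) ≤ minimaxRisk (besovBall d s p τ) m σ q := by
  classical
  obtain ⟨c, hc0, hc2, hc⟩ := exists_bumpSum_mem_besovBall d hs p hτ
  obtain ⟨v, hv0, hv1, hv⟩ := exists_volume_bumpTop d
  refine ⟨c * v / 4, by positivity, fun m M σ hM hσ hmM => le_minimaxRisk fun x A => ?_⟩
  have hM0 : (0 : ℝ) < M := by exact_mod_cast hM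
  have hσ0 : (0 : ℝ) < σ := by exact_mod_cast pos_iff_ne_zero.2 hσ
  have : Nonempty (Fin M) := ⟨⟨0, hM⟩⟩
  set a : ℝ := c * (M : ℝ) ^ (-s)
  have ha : 0 < a := by positivity
  have hcardN : ((Finset.univ : Finset (Fin d → Fin M)).card : ℝ) = (M : ℝ) ^ d := by
    rw [Finset.card_univ, Fintype.card_fun, Fintype.card_fin, Fintype.card_fin]
    push_cast; rfl
  set sgn : Bool → ℝ := fun b => if b then 1 else -1
  have hsgn : ∀ b, |sgn b| = 1 := fun b => by cases b <;> simp [sgn]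
  set f : ((Fin d → Fin M) → Bool) → EuclideanSpace ℝ (Fin d) → ℝ := fun ω z =>
    a * bumpSum (fun i => sgn (ω i)) ((M : ℝ) • z)
  have hf : ∀ ω, f ω ∈ besovBall d s p τ := fun ω => by
    have := hc M hM (fun i => sgn (ω i)) Finset.univ (fun i => (hsgn _).le)
      (fun i hi => absurd (Finset.mem_univ i) hi) Finset.univ_nonempty
    rw [hcardN, div_self (by positivity), Real.one_rpow, mul_one] at this
    exact this
  have hfc : ∀ ω, Continuous (f ω) := fun ω =>
    continuous_const.mul ((continuous_bumpSum _).comp (continuous_const_smul _))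
  set cell : (Fin d → Fin M) → Set (EuclideanSpace ℝ (Fin d)) := fun i =>
    {z | (M : ℝ) • z - node i ∈ unitCube d}
  have hcellm : ∀ i, MeasurableSet (cell i) := fun i =>
    measurableSet_preimage_smul_sub _ _ (isOpen_unitCube d)
  have hcelld : Pairwise (Function.onFun Disjoint cell) := fun i j hij =>
    Set.disjoint_left.2 fun z hi hj => hij (node_eq_of_mem hi hj)
  -- The loss of coordinate `i` is the `L_1` error on its cell. These add up to at most the `L_1`
  -- error on the cube, hence to at most the `L_q` error.
  set l : (Fin d → Fin M) → Bool → (Fin m → ℝ) → ℝ≥0∞ := fun i b y =>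
    ∫⁻ z in cell i, ‖a * (sgn b * bump d ((M : ℝ) • z - node i)) - A y z‖ₑ
  set n : (Fin d → Fin M) → ℝ := fun i =>
    ∑ j, (if (M : ℝ) • x j - node i ∈ unitCube d then (1 : ℝ) else 0)
  set β : (Fin d → Fin M) → ℝ := fun i => 2 * a ^ 2 / (σ : ℝ) ^ 2 * n i
  have hG : ∀ ω y, ∑ i, l i (ω i) y
      ≤ eLpNorm (fun z => f ω z - A y z) q (cubeMeasure d) := by
    intro ω y
    have hmeas : AEStronglyMeasurable (fun z => f ω z - A y z) (cubeMeasure d) :=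
      (hfc ω).aestronglyMeasurable.sub (Lp.aestronglyMeasurable (A y))
    refine le_trans ?_ (eLpNorm_le_eLpNorm_of_exponent_le hq hmeas)
    rw [eLpNorm_one_eq_lintegral_enorm]
    calc ∑ i, l i (ω i) y = ∑ i, ∫⁻ z in cell i, ‖f ω z - A y z‖ₑ := by
          refine Finset.sum_congr rfl fun i _ => setLIntegral_congr_fun (hcellm i) fun z hz => ?_
          simp only [f]
          rw [bumpSum_eq_of_mem _ hz]
      _ = ∫⁻ z in ⋃ i, cell i, ‖f ω z - A y z‖ₑ := by
          rw [lintegral_iUnion hcellm hcelld, tsum_fintype]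
      _ ≤ _ := lintegral_mono_set (iUnion_subset fun i z hz => mem_unitCube_of_mem_cell hM hz)
  -- On the plateau of the cell the two candidates are `a` and `-a`, at distance `2 * a`.
  have hl : ∀ i y, 2 * ENNReal.ofReal (a * ((M : ℝ) ^ d)⁻¹ * v) ≤ l i true y + l i false y := by
    intro i y
    have hcU : cell i ⊆ unitCube d := fun z hz => mem_unitCube_of_mem_cell hM hz
    have hmA : AEMeasurable (fun z => A y z) (volume.restrict (cell i)) :=
      (Lp.aestronglyMeasurable (A y)).aemeasurable.mono_measure (Measure.restrict_mono_set _ hcU)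
    have hmb : Measurable fun z : EuclideanSpace ℝ (Fin d) =>
        a * (sgn true * bump d ((M : ℝ) • z - node i)) :=
      (continuous_const.mul (continuous_const.mul ((bump d).continuous.comp
        ((continuous_const_smul _).sub continuous_const)))).measurable
    have hTm : MeasurableSet {z : EuclideanSpace ℝ (Fin d) | (M : ℝ) • z - node i ∈ bumpTop d} :=
      measurableSet_preimage_smul_sub _ _ Metric.isOpen_ball
    calc 2 * ENNReal.ofReal (a * ((M : ℝ) ^ d)⁻¹ * v)
        = ∫⁻ _ in {z | (M : ℝ) • z - node i ∈ bumpTop d}, ENNReal.ofReal (2 * a) := by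
          rw [setLIntegral_const, volume_preimage_smul_sub hM0, hv,
            ← ENNReal.ofReal_mul (by positivity), ← ENNReal.ofReal_mul (by positivity),
            ← ENNReal.ofReal_ofNat 2, ← ENNReal.ofReal_mul (by positivity)]
          congr 1
          ring
      _ ≤ ∫⁻ z in {z | (M : ℝ) • z - node i ∈ bumpTop d},
          (‖a * (sgn true * bump d ((M : ℝ) • z - node i)) - A y z‖ₑ
            + ‖a * (sgn false * bump d ((M : ℝ) • z - node i)) - A y z‖ₑ) := by
          refine setLIntegral_mono' hTm fun z hz => ?_
          rw [bump_eq_one hz, mul_one, mul_one]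
          calc ENNReal.ofReal (2 * a) = ‖(a * sgn true - A y z) - (a * sgn false - A y z)‖ₑ := by
                rw [← Real.enorm_eq_ofReal (by positivity)]
                congr 1
                simp [sgn]
                ring
            _ ≤ _ := enorm_sub_le
      _ ≤ ∫⁻ z in cell i, (‖a * (sgn true * bump d ((M : ℝ) • z - node i)) - A y z‖ₑ
            + ‖a * (sgn false * bump d ((M : ℝ) • z - node i)) - A y z‖ₑ) :=
          lintegral_mono_set fun z hz => bumpTop_subset d hz
      _ = l i true y + l i false y := lintegral_add_left' (hmb.aemeasurable.sub hmA).enorm _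
  -- A flip changes each of the `n i` observations in its cell by at most `2 * a` and no other
  -- observation.
  have hβ : ∀ ω i, (∑ j, (f (Function.update ω i (!ω i)) (x j) - f ω (x j)) ^ 2)
      / (2 * (σ : ℝ) ^ 2) ≤ β i := by
    intro ω i
    have hterm : ∀ j, (f (Function.update ω i (!ω i)) (x j) - f ω (x j)) ^ 2
        ≤ 4 * a ^ 2 * (if (M : ℝ) • x j - node i ∈ unitCube d then (1 : ℝ) else 0) := by
      intro j
      have hdiff : f (Function.update ω i (!ω i)) (x j) - f ω (x j)
          = a * ((sgn (!ω i) - sgn (ω i)) * bump d ((M : ℝ) • x j - node i)) := by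
        simp only [f, bumpSum]
        rw [← mul_sub, ← Finset.sum_sub_distrib]
        congr 1
        rw [Finset.sum_eq_single i]
        · rw [Function.update_self, sub_mul]
        · intro k _ hk
          rw [Function.update_of_ne hk, sub_self]
        · exact fun h => absurd (Finset.mem_univ i) h
      have hs4 : (sgn (!ω i) - sgn (ω i)) ^ 2 = 4 := by
        cases ω i <;> norm_num [sgn]
      rw [hdiff, mul_pow a, mul_pow (sgn (!ω i) - sgn (ω i)), hs4]
      split_ifs with hmem
      · have hb1 : bump d ((M : ℝ) • x j - node i) ^ 2 ≤ 1 := by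
          rw [sq_le_one_iff_abs_le_one]
          exact abs_bump_le_one _
        nlinarith [sq_nonneg a]
      · have hb0 : bump d ((M : ℝ) • x j - node i) = 0 :=
          by_contra fun h => hmem (mem_unitCube_of_bump_ne_zero h)
        simp [hb0]
    calc _ ≤ (∑ j, 4 * a ^ 2 * (if (M : ℝ) • x j - node i ∈ unitCube d then (1 : ℝ) else 0))
          / (2 * (σ : ℝ) ^ 2) := by
          gcongr with j
          exact hterm j
      _ = β i := by
          rw [← Finset.mul_sum]
          simp only [β, n]
          field_simp
          ring
  have hassouad := assouad_bound hσ (fun ω j => f ω (x j))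
    (fun ω y => eLpNorm (fun z => f ω z - A y z) q (cubeMeasure d)) l β hG hl hβ
    (R := algorithmRisk (besovBall d s p τ) σ q x A)
    fun ω => upperIntegral_le_algorithmRisk (hf ω)
  refine le_trans ?_ hassouad
  -- Only the average of `β` is under control, as sites may cluster. The bound `exp (-β) ≥ 1 - β` is
  -- linear, so `∑ β ≤ M ^ d / 2` is enough; this uses `c ≤ 1 / 2`.
  have hsum : (M : ℝ) ^ d / 4 ≤ ∑ i, 2⁻¹ * Real.exp (-β i) := by
    have hβsum : ∑ i, β i ≤ (M : ℝ) ^ d / 2 := by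
      calc ∑ i, β i = 2 * a ^ 2 / (σ : ℝ) ^ 2 * ∑ i, n i := by
            rw [Finset.mul_sum]
        _ ≤ 2 * a ^ 2 / (σ : ℝ) ^ 2 * m := by
            gcongr
            exact sum_data_in_cells_le x
        _ ≤ _ := by
            have ha2 : a ^ 2 = c ^ 2 * (M : ℝ) ^ (-(2 * s)) := by
              simp only [a]
              rw [mul_pow, ← Real.rpow_natCast (_ ^ _), ← Real.rpow_mul hM0.le]
              congr 2
              push_cast
              ring
            have hc4 : c ^ 2 ≤ 1 / 4 := by nlinarith
            rw [ha2, div_mul_eq_mul_div, div_le_iff₀ (by positivity)]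
            calc _ = 2 * c ^ 2 * (m * (M : ℝ) ^ (-(2 * s))) := by ring
              _ ≤ 2 * (1 / 4) * ((σ : ℝ) ^ 2 * (M : ℝ) ^ d) := by gcongr
              _ = _ := by ring
    calc (M : ℝ) ^ d / 4 ≤ 2⁻¹ * ((M : ℝ) ^ d - ∑ i, β i) := by linarith
      _ = ∑ i, 2⁻¹ * (1 - β i) := by
          rw [← Finset.mul_sum Finset.univ fun i => 1 - β i, Finset.sum_sub_distrib, Finset.sum_const, nsmul_eq_mul, mul_one,
            hcardN]
      _ ≤ _ := by
          gcongr with i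
          linarith [Real.add_one_le_exp (-β i)]
  have hconv : ∑ i, 2⁻¹ * ENNReal.ofReal (Real.exp (-β i))
      = ENNReal.ofReal (∑ i, 2⁻¹ * Real.exp (-β i)) := by
    rw [ENNReal.ofReal_sum_of_nonneg fun i _ => by positivity]
    refine Finset.sum_congr rfl fun i _ => ?_
    rw [ENNReal.ofReal_mul (by norm_num), ENNReal.ofReal_inv_of_pos two_pos, ENNReal.ofReal_ofNat]
  rw [hconv, ← ENNReal.ofReal_mul (by positivity)]
  refine ENNReal.ofReal_le_ofReal ?_
  calc c * v / 4 * (M : ℝ) ^ (-s) = a * ((M : ℝ) ^ d)⁻¹ * v * ((M : ℝ) ^ d / 4) := by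
        simp only [a]
        field_simp
    _ ≤ _ := by gcongr

/-- The resolution `M` is the least integer with `M ^ (2s + d) ≥ m / σ²`, the coarsest grid on which
the signs stay hidden. -/
theorem exists_noise_bound (d : ℕ) {s : ℝ} (hs : 0 < s) (p : ℝ≥0∞) {τ q : ℝ≥0∞}
    (hτ : 0 < τ) (hq : 1 ≤ q) :
    ∃ C : ℝ, 0 < C ∧ ∀ (m : ℕ) (σ : ℝ≥0), 1 ≤ m →
      ENNReal.ofReal (C * min 1 (((σ : ℝ) ^ 2 / m) ^ (s / (2 * s + d))))
        ≤ minimaxRisk (besovBall d s p τ) m σ q := by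
  obtain ⟨C, hC0, hC⟩ := exists_bound_of_hidden_signs d hs p hτ hq
  refine ⟨C * 2 ^ (-s), by positivity, fun m σ hm => ?_⟩
  have hd0 : (0 : ℝ) ≤ d := Nat.cast_nonneg d
  have hD : 0 < 2 * s + d := by linarith
  by_cases hσ : σ = 0
  · rw [hσ, NNReal.coe_zero, zero_pow two_ne_zero, zero_div,
      Real.zero_rpow (div_pos hs hD).ne', min_eq_right zero_le_one, mul_zero, ENNReal.ofReal_zero]
    exact zero_le
  have hσ0 : (0 : ℝ) < σ := by exact_mod_cast pos_iff_ne_zero.2 hσ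
  have hm0 : (0 : ℝ) < m := by exact_mod_cast hm
  set u : ℝ := (m : ℝ) / (σ : ℝ) ^ 2
  have hu : 0 < u := by positivity
  set M : ℕ := ⌈u ^ (1 / (2 * s + d))⌉₊
  have hut : 0 < u ^ (1 / (2 * s + d)) := by positivity
  have hM : 1 ≤ M := Nat.ceil_pos.2 hut
  have hM0 : (0 : ℝ) < M := by exact_mod_cast hM
  have hMge : u ^ (1 / (2 * s + d)) ≤ M := Nat.le_ceil _
  have hMlt : (M : ℝ) < u ^ (1 / (2 * s + d)) + 1 := Nat.ceil_lt_add_one hut.le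
  have hcond : (m : ℝ) * (M : ℝ) ^ (-(2 * s)) ≤ (σ : ℝ) ^ 2 * (M : ℝ) ^ d := by
    have huM : u ≤ (M : ℝ) ^ (2 * s + d) := by
      calc u = (u ^ (1 / (2 * s + d))) ^ (2 * s + d) := by
            rw [← Real.rpow_mul hu.le, one_div_mul_cancel hD.ne', Real.rpow_one]
        _ ≤ _ := by gcongr
    calc (m : ℝ) * (M : ℝ) ^ (-(2 * s)) = (σ : ℝ) ^ 2 * u * (M : ℝ) ^ (-(2 * s)) := by
          simp only [u]
          field_simp
      _ ≤ (σ : ℝ) ^ 2 * (M : ℝ) ^ (2 * s + d) * (M : ℝ) ^ (-(2 * s)) := by gcongr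
      _ = _ := by
          rw [mul_assoc, ← Real.rpow_add hM0, add_neg_cancel_comm, Real.rpow_natCast]
  refine le_trans (ENNReal.ofReal_le_ofReal ?_) (hC m M σ hM hσ hcond)
  rw [mul_assoc]
  gcongr
  have hrate : ((σ : ℝ) ^ 2 / m) ^ (s / (2 * s + d)) = (u ^ (1 / (2 * s + d))) ^ (-s) := by
    rw [← Real.rpow_mul hu.le, ← inv_div, Real.inv_rpow hu.le, ← Real.rpow_neg hu.le]
    congr 1
    ring
  rw [hrate]
  -- Rounding up at most doubles a number above one. Below one it gives `M = 1`, where the bound is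
  -- a constant and the minimum with `1` takes over.
  rcases le_total 1 (u ^ (1 / (2 * s + d))) with h | h
  · calc _ ≤ 2 ^ (-s) * (u ^ (1 / (2 * s + d))) ^ (-s) := by gcongr; exact min_le_right _ _
      _ = (2 * u ^ (1 / (2 * s + d))) ^ (-s) := (Real.mul_rpow two_pos.le hut.le).symm
      _ ≤ _ := Real.rpow_le_rpow_of_nonpos hM0 (by linarith) (by linarith)
  · calc _ ≤ (2 : ℝ) ^ (-s) * 1 := by gcongr; exact min_le_left _ _
      _ = (2 : ℝ) ^ (-s) := mul_one _
      _ ≤ _ := Real.rpow_le_rpow_of_nonpos hM0 (by linarith) (by linarith)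

end OptimalRecovery

/-! ### Combination of the two bounds -/

theorem theorem1p2 (d : ℕ) (hd : 1 ≤ d) (s : ℝ) (hs : 0 < s)
    (p τ q : ℝ≥0∞) (hp : 0 < p) (hτ : 0 < τ) (hq : 1 ≤ q)
    (hsp : (d : ℝ) * (p⁻¹).toReal < s)
    (hprimary : q < p + 2 * (ENNReal.ofReal s * p / d) ∨ (p = ∞ ∧ q = ∞)) :
    ∃ C : ℝ, 0 < C ∧ ∀ (m : ℕ) (σ : ℝ≥0), 1 ≤ m →
      ENNReal.ofReal (C *
          ((m : ℝ) ^ (-(s / d) + max ((p⁻¹).toReal - (q⁻¹).toReal) 0)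
            + min 1 (((σ : ℝ) ^ 2 / m) ^ (s / (2 * s + d)))))
        ≤ OptimalRecovery.minimaxRisk (OptimalRecovery.besovBall d s p τ) m σ q := by
  obtain ⟨C₁, h₁, H₁⟩ := OptimalRecovery.exists_deterministic_bound (p := p) (τ := τ) hd hs hτ hq hsp
  obtain ⟨C₂, h₂, H₂⟩ := OptimalRecovery.exists_noise_bound d hs p (τ := τ) hτ hq
  refine ⟨min C₁ C₂ / 2, by positivity, fun m σ hm => ?_⟩
  set a := (m : ℝ) ^ (-(s / d) + max ((p⁻¹).toReal - (q⁻¹).toReal) 0)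
  set b := min 1 (((σ : ℝ) ^ 2 / m) ^ (s / (2 * s + d)))
  have ha : 0 ≤ a := by positivity
  have hb : 0 ≤ b := le_min zero_le_one (by positivity)
  have hle : min C₁ C₂ / 2 * (a + b) ≤ max (C₁ * a) (C₂ * b) := by
    have h1 : min C₁ C₂ * a ≤ C₁ * a := by gcongr; exact min_le_left _ _
    have h2 : min C₁ C₂ * b ≤ C₂ * b := by gcongr; exact min_le_right _ _
    have h3 := le_max_left (C₁ * a) (C₂ * b)
    have h4 := le_max_right (C₁ * a) (C₂ * b)
    linarith
  refine (ENNReal.ofReal_le_ofReal hle).trans ?_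
  rw [ENNReal.ofReal_max]
  exact max_le (H₁ m σ hm) (H₂ m σ hm)
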